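/- **Setting.** Let $\varepsilon\ge 0$, and let $(p_i)_{i\ge 0}=((x_i,y_i))_{i\ge 0}$ be a stream of points of $\mathbb R^2$ with $x_0<x_1<x_2<\cdots$. A line $y=ax+b$ is *valid* for the first $n$ points if $|y_i-(ax_i+b)|\le\varepsilon$ for all $i<n$. The *min hull* of the first $n$ points is the upper part of the convex hull of the lower endpoints $(x_i,y_i-\varepsilon)$, $i<n$, of the error segments: its vertices are the vertices of this convex hull that lie on or above the line joining its leftmost and rightmost points. The *max hull* is the lower part of the convex hull of the upper endpoints $(x_i,y_i+\varepsilon)$, $i<n$, defined symmetrically. Let $h_n$ be the larger of the numbers of vertices of the min hull and of the max hull of the first $n$ points. **Model.** Programs run on a real RAM: finite while-programs with finitely many variables and arrays (indexed by natural numbers) holding natural numbers or exact real numbers. The elementary operations are copying, loading from and storing into arrays, constants, addition, truncated subtraction and halving (rounded down) of natural numbers, conversion of a natural number to a real, and $+,-,\times,/$ on reals (with $r/0=0$); tests are comparisons $\le$ of two natural numbers or of two reals. There is no rounding of reals to integers. Every elementary operation (including the empty instruction) and every test costs one step. A program is used as a streaming algorithm: $\varepsilon$ is stored in its memory at the start,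 with everything else $0$; the points are delivered one at a time, and the program is executed once on each point, its memory being kept from one point to the next. It *decides valid lines for $\varepsilon$* if, on every stream as above and for every $n\ge 0$, it halts after receiving the point $p_n$ with the correct answer to the question whether there is a line that is valid for the first $n+1$ points. Its *time on $p_n$* is the number of steps of its execution on $p_n$, which includes all updates of its data. **Theorem.** 1. (Upper bound.) There are a program and a constant $C$ such that, for every $\varepsilon\ge 0$, the program decides valid lines for $\varepsilon$ and, on every stream and for every $n\ge 0$, its time on $p_n$ (after the first $n$ points have been processed) is at most $C\log\max(2,h_n)$, that is, $O(\log h_n)$. (For $n\ge 2$ one has $h_n\ge 2$.) 2. (Optimality.) There are constants $c>0$ and $h_0$ such that for every $\varepsilon>0$, every program that decides valid lines for $\varepsilon$, and every $h\ge h_0$, there are a stream and an $n$ such that the first $n$ points have a valid line, $h_n=h$, and the time of the program on $p_n$ is at least $c\log h$. -/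

import Mathlib

/-! ### Valid lines and the partial convex hulls of a stream of points -/

/-- The line `y = a * x + b` stays within `ε` of the first `n` points of the stream, for some
`a` and `b`. -/
def HasValidLine (ε : ℝ) (p : ℕ → ℝ × ℝ) (n : ℕ) : Prop :=
  ∃ a b : ℝ, ∀ i < n, |(p i).2 - (a * (p i).1 + b)| ≤ ε

/-- The lower endpoints of the error segments of the first `n` points. -/
def lowerEndpoints (ε : ℝ) (p : ℕ → ℝ × ℝ) (n : ℕ) : Set (ℝ × ℝ) :=
  {q | ∃ i < n, q = ((p i).1, (p i).2 - ε)}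

/-- The upper endpoints of the error segments of the first `n` points. -/
def upperEndpoints (ε : ℝ) (p : ℕ → ℝ × ℝ) (n : ℕ) : Set (ℝ × ℝ) :=
  {q | ∃ i < n, q = ((p i).1, (p i).2 + ε)}

/-- `q` lies on or above the line through `u` and `v`, where `u.1 < v.1`. -/
def OnOrAbove (u v q : ℝ × ℝ) : Prop :=
  (v.2 - u.2) * (q.1 - u.1) ≤ (q.2 - u.2) * (v.1 - u.1)

/-- `q` lies on or below the line through `u` and `v`, where `u.1 < v.1`. -/
def OnOrBelow (u v q : ℝ × ℝ) : Prop :=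
  (q.2 - u.2) * (v.1 - u.1) ≤ (v.2 - u.2) * (q.1 - u.1)

/-- The vertices of the min hull of the first `n` points: the vertices of the convex hull of the
lower endpoints that lie on or above the line joining its leftmost to its rightmost point (the
abscissae of the stream increase, so these come from the points `0` and `n - 1`). -/
def minHullVertices (ε : ℝ) (p : ℕ → ℝ × ℝ) (n : ℕ) : Set (ℝ × ℝ) :=
  {q | q ∈ (convexHull ℝ (lowerEndpoints ε p n)).extremePoints ℝ ∧
    OnOrAbove ((p 0).1, (p 0).2 - ε) ((p (n - 1)).1, (p (n - 1)).2 - ε) q}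

/-- The vertices of the max hull of the first `n` points: the vertices of the convex hull of the
upper endpoints that lie on or below the line joining its leftmost to its rightmost point. -/
def maxHullVertices (ε : ℝ) (p : ℕ → ℝ × ℝ) (n : ℕ) : Set (ℝ × ℝ) :=
  {q | q ∈ (convexHull ℝ (upperEndpoints ε p n)).extremePoints ℝ ∧
    OnOrBelow ((p 0).1, (p 0).2 + ε) ((p (n - 1)).1, (p (n - 1)).2 + ε) q}

/-- The larger of the numbers of vertices of the two partial hulls of the first `n` points. -/
noncomputable def hullSize (ε : ℝ) (p : ℕ → ℝ × ℝ) (n : ℕ) : ℕ :=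
  max (minHullVertices ε p n).ncard (maxHullVertices ε p n).ncard

/-! ### The real RAM

Programs work on natural number variables, real variables, and arrays of both kinds, indexed by
natural numbers.  Real numbers are exact and can be added, subtracted, multiplied, divided and
compared; they cannot be rounded to integers.  Every elementary instruction and every evaluated
test costs one step. -/

namespace RealRAM

/-- The contents of the memory: variables and arrays are named by natural numbers. -/
structure State where
  nat : ℕ → ℕ
  real : ℕ → ℝ
  natArr : ℕ → ℕ → ℕ
  realArr : ℕ → ℕ → ℝ

/-- Elementary instructions; `d` is the destination variable. -/
inductive Instr : Type
  | natConst (d k : ℕ)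
  | natCopy (d a : ℕ)
  | natAdd (d a b : ℕ)
  | natSub (d a b : ℕ)
  | natHalf (d a : ℕ)
  | natLoad (d arr idx : ℕ)
  | natStore (arr idx a : ℕ)
  | toReal (d a : ℕ)
  | realCopy (d a : ℕ)
  | realAdd (d a b : ℕ)
  | realSub (d a b : ℕ)
  | realMul (d a b : ℕ)
  | realDiv (d a b : ℕ)
  | realLoad (d arr idx : ℕ)
  | realStore (arr idx a : ℕ)

namespace State

def setNat (s : State) (d v : ℕ) : State :=
  { s with nat := Function.update s.nat d v }

noncomputable def setReal (s : State) (d : ℕ) (v : ℝ) : State :=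
  { s with real := Function.update s.real d v }

def setNatArr (s : State) (arr i v : ℕ) : State :=
  { s with natArr := Function.update s.natArr arr (Function.update (s.natArr arr) i v) }

noncomputable def setRealArr (s : State) (arr i : ℕ) (v : ℝ) : State :=
  { s with realArr := Function.update s.realArr arr (Function.update (s.realArr arr) i v) }

end State

/-- The effect of an instruction.  Subtraction of natural numbers is truncated at `0`, halving
rounds down, and a division of reals by `0` gives `0`. -/
noncomputable def Instr.apply : Instr → State → State
  | .natConst d k, s => s.setNat d k
  | .natCopy d a, s => s.setNat d (s.nat a)
  | .natAdd d a b, s => s.setNat d (s.nat a + s.nat b)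
  | .natSub d a b, s => s.setNat d (s.nat a - s.nat b)
  | .natHalf d a, s => s.setNat d (s.nat a / 2)
  | .natLoad d arr idx, s => s.setNat d (s.natArr arr (s.nat idx))
  | .natStore arr idx a, s => s.setNatArr arr (s.nat idx) (s.nat a)
  | .toReal d a, s => s.setReal d (s.nat a : ℝ)
  | .realCopy d a, s => s.setReal d (s.real a)
  | .realAdd d a b, s => s.setReal d (s.real a + s.real b)
  | .realSub d a b, s => s.setReal d (s.real a - s.real b)
  | .realMul d a b, s => s.setReal d (s.real a * s.real b)
  | .realDiv d a b, s => s.setReal d (s.real a / s.real b)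
  | .realLoad d arr idx, s => s.setReal d (s.realArr arr (s.nat idx))
  | .realStore arr idx a, s => s.setRealArr arr (s.nat idx) (s.real a)

/-- Tests: comparisons of two variables of the same kind. -/
inductive Test : Type
  | natLe (a b : ℕ)
  | realLe (a b : ℕ)

def Test.Holds : Test → State → Prop
  | .natLe a b, s => s.nat a ≤ s.nat b
  | .realLe a b, s => s.real a ≤ s.real b

/-- Programs: `loop T c` repeats `c` as long as the test `T` holds. -/
inductive Program : Type
  | skip
  | instr (i : Instr)
  | seq (c₁ c₂ : Program)
  | ite (T : Test) (c₁ c₂ : Program)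
  | loop (T : Test) (c : Program)

/-- `Exec c s t s'`: started in the state `s`, the program `c` halts in the state `s'` after
exactly `t` steps. -/
inductive Exec : Program → State → ℕ → State → Prop
  | skip (s : State) : Exec .skip s 1 s
  | instr (i : Instr) (s : State) : Exec (.instr i) s 1 (i.apply s)
  | seq {c₁ c₂ : Program} {s s' s'' : State} {t t' : ℕ} :
      Exec c₁ s t s' → Exec c₂ s' t' s'' → Exec (.seq c₁ c₂) s (t + t') s''
  | iteTrue {T : Test} {c₁ c₂ : Program} {s s' : State} {t : ℕ} :
      T.Holds s → Exec c₁ s t s' → Exec (.ite T c₁ c₂) s (t + 1) s'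
  | iteFalse {T : Test} {c₁ c₂ : Program} {s s' : State} {t : ℕ} :
      ¬ T.Holds s → Exec c₂ s t s' → Exec (.ite T c₁ c₂) s (t + 1) s'
  | loopTrue {T : Test} {c : Program} {s s' s'' : State} {t t' : ℕ} :
      T.Holds s → Exec c s t s' → Exec (.loop T c) s' t' s'' →
      Exec (.loop T c) s (t + t' + 1) s''
  | loopFalse {T : Test} {c : Program} {s : State} :
      ¬ T.Holds s → Exec (.loop T c) s 1 s

/-- The initial memory: real variable `2` holds the threshold, everything else is `0`. -/
noncomputable def initial (ε : ℝ) : State where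
  nat := fun _ => 0
  real := fun k => if k = 2 then ε else 0
  natArr := fun _ _ => 0
  realArr := fun _ _ => 0

/-- A new point is delivered in the real variables `0` and `1`. -/
noncomputable def State.feed (s : State) (q : ℝ × ℝ) : State :=
  (s.setReal 0 q.1).setReal 1 q.2

/-- The streaming run of the program `P` on the stream `p`: the memory is kept from one point to
the next, `σ n` is the memory after the first `n` points have been processed, and `τ n` is the
number of steps that are then spent on the next point `p n`. -/
def IsRun (P : Program) (ε : ℝ) (p : ℕ → ℝ × ℝ) (σ : ℕ → State) (τ : ℕ → ℕ) : Prop :=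
  σ 0 = initial ε ∧ ∀ n, Exec P ((σ n).feed (p n)) (τ n) (σ (n + 1))

/-- The answer is yes if natural number variable `0` holds `1`. -/
def State.SaysYes (s : State) : Prop := s.nat 0 = 1

/-- On every stream with strictly increasing abscissae, after each point `p n` the program halts
with the correct answer to the question whether the first `n + 1` points have a valid line. -/
def DecidesValidLine (P : Program) (ε : ℝ) : Prop :=
  ∀ p : ℕ → ℝ × ℝ, StrictMono (fun i => (p i).1) →
    ∃ (σ : ℕ → State) (τ : ℕ → ℕ), IsRun P ε p σ τ ∧
      ∀ n, (σ (n + 1)).SaysYes ↔ HasValidLine ε p (n + 1)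

end RealRAM

/-!
A line `y = a * x + b` is valid iff it is above all lower endpoints and below all upper endpoints of
the error segments.  For fixed `a` the points confine `b` to intervals, so that some `b` exists iff
the intervals intersect pairwise.  Hence there is a valid line iff the largest slope of a segment
from an upper endpoint to a later lower endpoint is at most the smallest slope of a segment from a
lower endpoint to a later upper endpoint (`hasValidLine_iff_exists_slope`).  Reflection at the
horizontal axis exchanges these two slopes, and also the min hull and the max hull.

*Upper bound.*  For the stream and for its reflection the program `RealRAM.validLineProgram` stores
the smallest slope and the vertices of the min hull, as a strictly concave chain in an array
(`IsHullChain`).  For a new point, the new slopes are bounded below by the slope of the tangent from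
its upper endpoint to the min hull, and the new min hull is cut off at the tangent point as seen
from its lower endpoint (`IsSideData.step`).  A tangent point is characterized by the position of
the new point relative to two consecutive edges, so a binary search finds it
(`RealRAM.exec_search`).  The vertices behind it are dropped by lowering the stored length, which
takes constant time.  All stored points are vertices of the hull (`IsHullChain.card_le`), so the
search takes `O(log h)` steps.

*Lower bound.*  A single answer need not be hard, but two consecutive ones are.  In the stream
`hardStream` the first points put `K` lower endpoints on a parabola.  The next two points depend
on a parameter `θ`: the first brings an upper endpoint from which the tangent of the min hull has to
be found, and the lower endpoint of the second one tests whether the tangent is known.  There is a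
valid line for all odd `θ < 2 * K` and for no even `θ` between `2` and `2 * K`.  On the other hand,
two rounds of at most `t` steps unroll into a binary tree of depth at most `2 * t + 2`, in which all
real numbers are rational functions of `θ` whose degree at most doubles in each step; so the answer
changes at most `2 ^ O(t)` times (`RealRAM.ComputationTree.answer_changes_le`), and `t` is at least
of the order of `log K`.  The hull has to have the same size `K + 1` before either of the two points.
This is achieved by one more early point, far below the parabola: it is a vertex at first, and the
lower endpoint of the first of the two points takes its place.
-/

namespace RealRAM

/-! ### Determinism of executions and runs -/

theorem Exec.deterministic {c : Program} {s : State} {t : ℕ} {s' : State} (h : Exec c s t s') :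
    ∀ {t₂ : ℕ} {s₂ : State}, Exec c s t₂ s₂ → t = t₂ ∧ s' = s₂ := by
  induction h with
  | skip s => intro t₂ s₂ h; cases h; exact ⟨rfl, rfl⟩
  | instr i s => intro t₂ s₂ h; cases h; exact ⟨rfl, rfl⟩
  | seq _ _ ih₁ ih₂ =>
    intro t₂ s₂ h
    cases h with
    | seq h₁ h₂ =>
      obtain ⟨rfl, rfl⟩ := ih₁ h₁
      obtain ⟨rfl, rfl⟩ := ih₂ h₂
      exact ⟨rfl, rfl⟩
  | iteTrue hT _ ih =>
    intro t₂ s₂ h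
    cases h with
    | iteTrue _ h₁ => obtain ⟨rfl, rfl⟩ := ih h₁; exact ⟨rfl, rfl⟩
    | iteFalse hF _ => exact absurd hT hF
  | iteFalse hF _ ih =>
    intro t₂ s₂ h
    cases h with
    | iteTrue hT _ => exact absurd hT hF
    | iteFalse _ h₁ => obtain ⟨rfl, rfl⟩ := ih h₁; exact ⟨rfl, rfl⟩
  | loopTrue hT _ _ ih₁ ih₂ =>
    intro t₂ s₂ h
    cases h with
    | loopTrue _ h₁ h₂ =>
      obtain ⟨rfl, rfl⟩ := ih₁ h₁
      obtain ⟨rfl, rfl⟩ := ih₂ h₂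
      exact ⟨rfl, rfl⟩
    | loopFalse hF => exact absurd hT hF
  | loopFalse hF =>
    intro t₂ s₂ h
    cases h with
    | loopTrue hT _ _ => exact absurd hT hF
    | loopFalse _ => exact ⟨rfl, rfl⟩

/-- The memory after `n` points depends only on these points. -/
theorem IsRun.state_eq {P : Program} {ε : ℝ} {p p' : ℕ → ℝ × ℝ} {σ σ' : ℕ → State}
    {τ τ' : ℕ → ℕ} (h : IsRun P ε p σ τ) (h' : IsRun P ε p' σ' τ') {n : ℕ}
    (hp : ∀ i < n, p i = p' i) : σ n = σ' n := by
  induction n with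
  | zero => rw [h.1, h'.1]
  | succ n ih =>
    have e := ih fun i hi => hp i (by omega)
    have h₁ := h.2 n
    rw [e, hp n (by omega)] at h₁
    exact (h₁.deterministic (h'.2 n)).2

theorem IsRun.time_eq {P : Program} {ε : ℝ} {p : ℕ → ℝ × ℝ} {σ σ' : ℕ → State}
    {τ τ' : ℕ → ℕ} (h : IsRun P ε p σ τ) (h' : IsRun P ε p σ' τ') (n : ℕ) : τ n = τ' n := by
  have h₁ := h.2 n
  rw [h.state_eq h' fun _ _ => rfl] at h₁
  exact (h₁.deterministic (h'.2 n)).1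

end RealRAM

namespace RealRAM

/-! ### Computation trees -/

/-- Bounded executions of a program, unrolled into a binary tree.  Apart from instructions and
tests a tree may read an input: `input d f T` stores in the real variable `d` the value at the
parameter of the polynomial `f`, which is at most quadratic. -/
inductive ComputationTree : Type
  | fail
  | leaf
  | act (i : Instr) (T : ComputationTree)
  | input (d : ℕ) (f : Polynomial ℝ) (hf : f.natDegree ≤ 2) (T : ComputationTree)
  | branch (T : Test) (A B : ComputationTree)

namespace ComputationTree

/-- The length of the longest path. -/
def depth : ComputationTree → ℕ
  | fail => 0
  | leaf => 0
  | act _ T => T.depth + 1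
  | input _ _ _ T => T.depth + 1
  | branch _ A B => max A.depth B.depth + 1

open Classical in
/-- The state that is reached at a leaf when the parameter has the value `θ`, if any. -/
noncomputable def run (θ : ℝ) : ComputationTree → State → Option State
  | fail, _ => none
  | leaf, s => some s
  | act i T, s => T.run θ (i.apply s)
  | input d f _ T, s => T.run θ (s.setReal d (f.eval θ))
  | branch T A B, s => if T.Holds s then A.run θ s else B.run θ s

/-- Unrolling of a loop with test `T` for at most `j` rounds; `body` unrolls the body and `k` is
what follows the loop.  The last argument is the number of steps that are left. -/
def loop (T : Test) (body : (ℕ → ComputationTree) → ℕ → ComputationTree)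
    (k : ℕ → ComputationTree) : ℕ → ℕ → ComputationTree
  | 0, _ => fail
  | _ + 1, 0 => fail
  | j + 1, n + 1 => branch T (body (loop T body k j) n) (k n)

end ComputationTree

open ComputationTree

/-- The executions of a program that take at most `n` steps, unrolled into a tree that goes on
as `k m` when the program has halted with `m` steps left. -/
def Program.tree : Program → (ℕ → ComputationTree) → ℕ → ComputationTree
  | .skip, _, 0 => .fail
  | .skip, k, n + 1 => k n
  | .instr _, _, 0 => .fail
  | .instr i, k, n + 1 => .act i (k n)
  | .seq c₁ c₂, k, n => c₁.tree (fun m => c₂.tree k m) n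
  | .ite _ _ _, _, 0 => .fail
  | .ite T c₁ c₂, k, n + 1 => .branch T (c₁.tree k n) (c₂.tree k n)
  | .loop T c, k, n => ComputationTree.loop T (fun k' m => c.tree k' m) k n n

theorem Program.depth_tree_le (c : Program) : ∀ (k : ℕ → ComputationTree) (e : ℕ),
    (∀ m, (k m).depth ≤ m + e) → ∀ n, (c.tree k n).depth ≤ n + e := by
  induction c with
  | skip =>
    intro k e hk n
    cases n with
    | zero => simp [Program.tree, depth]
    | succ n => have := hk n; simp only [Program.tree]; omega
  | instr i =>
    intro k e hk n
    cases n with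
    | zero => simp [Program.tree, depth]
    | succ n => have := hk n; simp only [Program.tree, depth]; omega
  | seq c₁ c₂ ih₁ ih₂ =>
    intro k e hk n
    exact ih₁ _ e (fun m => ih₂ k e hk m) n
  | ite T c₁ c₂ ih₁ ih₂ =>
    intro k e hk n
    cases n with
    | zero => simp [Program.tree, depth]
    | succ n =>
      have h₁ := ih₁ k e hk n
      have h₂ := ih₂ k e hk n
      simp only [Program.tree, depth]; omega
  | loop T c ih =>
    intro k e hk n
    have key : ∀ j m, (ComputationTree.loop T (fun k' m => c.tree k' m) k j m).depth ≤ m + e := by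
      intro j
      induction j with
      | zero => intro m; simp [ComputationTree.loop, depth]
      | succ j ihj =>
        intro m
        cases m with
        | zero => simp [ComputationTree.loop, depth]
        | succ m =>
          have h₁ := ih _ e ihj m
          have h₂ := hk m
          simp only [ComputationTree.loop, depth]; omega
    exact key n n

theorem Program.run_tree (θ : ℝ) (c : Program) : ∀ {s s' : State} {t : ℕ}, Exec c s t s' →
    ∀ (k : ℕ → ComputationTree) (n : ℕ), (c.tree k (t + n)).run θ s = (k n).run θ s' := by
  induction c with
  | skip =>
    intro s s' t h k n
    cases h
    rw [add_comm 1 n]; rfl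
  | instr i =>
    intro s s' t h k n
    cases h
    rw [add_comm 1 n]; rfl
  | seq c₁ c₂ ih₁ ih₂ =>
    intro s s' t h k n
    cases h with
    | seq h₁ h₂ =>
      simp only [Program.tree]
      rw [add_assoc, ih₁ h₁, ih₂ h₂]
  | ite T c₁ c₂ ih₁ ih₂ =>
    intro s s' t h k n
    cases h with
    | iteTrue hT h₁ =>
      rw [add_right_comm]
      simp only [Program.tree, run, if_pos hT, ih₁ h₁]
    | iteFalse hT h₁ =>
      rw [add_right_comm]
      simp only [Program.tree, run, if_neg hT, ih₂ h₁]
  | loop T c ih =>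
    intro s s' t h k n
    have key : ∀ {P : Program} {s s' : State} {t : ℕ}, Exec P s t s' → P = .loop T c →
        ∀ j, t ≤ j → (ComputationTree.loop T (fun k' m => c.tree k' m) k j (t + n)).run θ s =
          (k n).run θ s' := by
      intro P s s' t h
      induction h with
      | skip | instr | seq | iteTrue | iteFalse => intro hP; cases hP
      | loopTrue hT h₁ h₂ ih₁ ih₂ =>
        intro hP j hj
        cases hP
        obtain ⟨j, rfl⟩ : ∃ j', j = j' + 1 := ⟨j - 1, by omega⟩
        rw [add_right_comm, add_assoc _ _ n]
        simp only [ComputationTree.loop, run, if_pos hT]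
        rw [ih h₁]
        exact ih₂ rfl j (by omega)
      | loopFalse hT =>
        intro hP j hj
        cases hP
        obtain ⟨j, rfl⟩ : ∃ j', j = j' + 1 := ⟨j - 1, by omega⟩
        rw [add_comm 1 n]
        simp only [ComputationTree.loop, run, if_neg hT]
    exact key h rfl _ (Nat.le_add_right t n)

/-! ### Rational dependence on a parameter -/

/-- On the set `A` the function `f` is a quotient of two polynomials of degree at most `d`. -/
def IsRationalOn (d : ℕ) (A : Set ℝ) (f : ℝ → ℝ) : Prop :=
  ∃ N D : Polynomial ℝ, N.natDegree ≤ d ∧ D.natDegree ≤ d ∧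
    ∀ θ ∈ A, D.eval θ ≠ 0 ∧ f θ = N.eval θ / D.eval θ

theorem IsRationalOn.mono {d d' : ℕ} {A A' : Set ℝ} {f : ℝ → ℝ} (h : IsRationalOn d A f)
    (hd : d ≤ d') (hA : A' ⊆ A) : IsRationalOn d' A' f := by
  obtain ⟨N, D, hN, hD, h⟩ := h
  exact ⟨N, D, hN.trans hd, hD.trans hd, fun θ hθ => h θ (hA hθ)⟩

theorem IsRationalOn.congr {d : ℕ} {A : Set ℝ} {f g : ℝ → ℝ} (h : IsRationalOn d A f)
    (hfg : ∀ θ ∈ A, g θ = f θ) : IsRationalOn d A g := by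
  obtain ⟨N, D, hN, hD, h⟩ := h
  exact ⟨N, D, hN, hD, fun θ hθ => ⟨(h θ hθ).1, (hfg θ hθ).trans (h θ hθ).2⟩⟩

theorem isRationalOn_eval {d : ℕ} (A : Set ℝ) {f : Polynomial ℝ} (hf : f.natDegree ≤ d) :
    IsRationalOn d A (fun θ => f.eval θ) :=
  ⟨f, 1, hf, by simp, fun θ _ => by simp⟩

theorem isRationalOn_const (d : ℕ) (A : Set ℝ) (r : ℝ) : IsRationalOn d A (fun _ => r) :=
  ⟨Polynomial.C r, 1, by simp, by simp, fun θ _ => by simp⟩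

theorem natDegree_mul_le_two_mul {d : ℕ} {p q : Polynomial ℝ} (hp : p.natDegree ≤ d)
    (hq : q.natDegree ≤ d) : (p * q).natDegree ≤ 2 * d :=
  Polynomial.natDegree_mul_le.trans (by omega)

theorem IsRationalOn.add {d : ℕ} {A : Set ℝ} {f g : ℝ → ℝ} (hf : IsRationalOn d A f)
    (hg : IsRationalOn d A g) : IsRationalOn (2 * d) A (fun θ => f θ + g θ) := by
  obtain ⟨N, D, hN, hD, h⟩ := hf
  obtain ⟨N', D', hN', hD', h'⟩ := hg
  refine ⟨N * D' + D * N', D * D', ?_, natDegree_mul_le_two_mul hD hD', fun θ hθ => ?_⟩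
  · exact Polynomial.natDegree_add_le_of_degree_le (natDegree_mul_le_two_mul hN hD')
      (natDegree_mul_le_two_mul hD hN')
  · obtain ⟨h₁, h₂⟩ := h θ hθ
    obtain ⟨h₁', h₂'⟩ := h' θ hθ
    simp only [Polynomial.eval_mul, Polynomial.eval_add]
    exact ⟨mul_ne_zero h₁ h₁', by rw [h₂, h₂', div_add_div _ _ h₁ h₁']⟩

theorem IsRationalOn.sub {d : ℕ} {A : Set ℝ} {f g : ℝ → ℝ} (hf : IsRationalOn d A f)
    (hg : IsRationalOn d A g) : IsRationalOn (2 * d) A (fun θ => f θ - g θ) := by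
  obtain ⟨N, D, hN, hD, h⟩ := hf
  obtain ⟨N', D', hN', hD', h'⟩ := hg
  refine ⟨N * D' - D * N', D * D', ?_, natDegree_mul_le_two_mul hD hD', fun θ hθ => ?_⟩
  · exact (Polynomial.natDegree_sub_le_of_le (natDegree_mul_le_two_mul hN hD')
      (natDegree_mul_le_two_mul hD hN')).trans (max_self _).le
  · obtain ⟨h₁, h₂⟩ := h θ hθ
    obtain ⟨h₁', h₂'⟩ := h' θ hθ
    simp only [Polynomial.eval_mul, Polynomial.eval_sub]
    exact ⟨mul_ne_zero h₁ h₁', by rw [h₂, h₂', div_sub_div _ _ h₁ h₁']⟩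

theorem IsRationalOn.mul {d : ℕ} {A : Set ℝ} {f g : ℝ → ℝ} (hf : IsRationalOn d A f)
    (hg : IsRationalOn d A g) : IsRationalOn (2 * d) A (fun θ => f θ * g θ) := by
  obtain ⟨N, D, hN, hD, h⟩ := hf
  obtain ⟨N', D', hN', hD', h'⟩ := hg
  refine ⟨N * N', D * D', natDegree_mul_le_two_mul hN hN', natDegree_mul_le_two_mul hD hD',
    fun θ hθ => ?_⟩
  obtain ⟨h₁, h₂⟩ := h θ hθ
  obtain ⟨h₁', h₂'⟩ := h' θ hθ
  simp only [Polynomial.eval_mul]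
  exact ⟨mul_ne_zero h₁ h₁', by rw [h₂, h₂', div_mul_div_comm]⟩

theorem card_roots_toFinset_le (Q : Polynomial ℝ) : Q.roots.toFinset.card ≤ Q.natDegree :=
  (Multiset.toFinset_card_le _).trans (Polynomial.card_roots' Q)

/-- A quotient is rational away from the zeros of the divisor, unless the divisor vanishes
identically and the quotient is `0` by convention. -/
theorem IsRationalOn.div {d : ℕ} {A : Set ℝ} {f g : ℝ → ℝ} (hf : IsRationalOn d A f)
    (hg : IsRationalOn d A g) : ∃ R : Finset ℝ, R.card ≤ d ∧
      IsRationalOn (2 * d) (A \ R) (fun θ => f θ / g θ) := by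
  obtain ⟨N, D, hN, hD, h⟩ := hf
  obtain ⟨N', D', hN', hD', h'⟩ := hg
  by_cases h0 : N' = 0
  · refine ⟨∅, by simp, (isRationalOn_const _ _ 0).congr fun θ hθ => ?_⟩
    simp [(h' θ hθ.1).2, h0]
  · refine ⟨N'.roots.toFinset, (card_roots_toFinset_le N').trans hN', N * D', D * N',
      natDegree_mul_le_two_mul hN hD', natDegree_mul_le_two_mul hD hN', fun θ hθ => ?_⟩
    obtain ⟨h₁, h₂⟩ := h θ hθ.1
    obtain ⟨h₁', h₂'⟩ := h' θ hθ.1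
    have h3 : N'.eval θ ≠ 0 := fun h3 => hθ.2 (by
      simpa [Polynomial.mem_roots', Polynomial.IsRoot] using ⟨h0, h3⟩)
    simp only [Polynomial.eval_mul]
    exact ⟨mul_ne_zero h₁ h3, by rw [h₂, h₂', div_div_div_eq]⟩

/-- A polynomial without a root in an interval has the same sign at both ends. -/
theorem eval_nonpos_iff_of_no_root {Q : Polynomial ℝ} {a b : ℝ} (hab : a ≤ b)
    (h : ∀ r ∈ Q.roots.toFinset, r ∉ Set.Icc a b) : Q.eval a ≤ 0 ↔ Q.eval b ≤ 0 := by
  by_cases h0 : Q = 0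
  · simp [h0]
  have hc : ContinuousOn (fun x => Q.eval x) (Set.Icc a b) := Q.continuous.continuousOn
  have key : ∀ r ∈ Set.Icc a b, Q.eval r ≠ 0 := fun r hr h3 => h r (by
    simpa [Polynomial.mem_roots', Polynomial.IsRoot] using ⟨h0, h3⟩) hr
  constructor
  · intro h1
    by_contra! h2
    obtain ⟨r, hr, hr0⟩ := intermediate_value_Icc hab hc ⟨h1, h2.le⟩
    exact key r hr hr0
  · intro h1
    by_contra! h2
    obtain ⟨r, hr, hr0⟩ := intermediate_value_Icc' hab hc ⟨h1, h2.le⟩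
    exact key r hr hr0

/-- The outcome of a comparison of two rational functions changes only at boundedly many places. -/
theorem IsRationalOn.le_iff {d : ℕ} {A : Set ℝ} {f g : ℝ → ℝ} (hf : IsRationalOn d A f)
    (hg : IsRationalOn d A g) : ∃ R : Finset ℝ, R.card ≤ 4 * d ∧
      ∀ θ ∈ A, ∀ θ' ∈ A, θ ≤ θ' → (∀ r ∈ R, r ∉ Set.Icc θ θ') →
        (f θ ≤ g θ ↔ f θ' ≤ g θ') := by
  obtain ⟨N, D, hN, hD, h⟩ := hf
  obtain ⟨N', D', hN', hD', h'⟩ := hg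
  -- Multiplication with the squares of both denominators keeps the sign of the difference.
  set Q : Polynomial ℝ := (N * D' - N' * D) * (D * D')
  have hQ : ∀ θ ∈ A, (f θ ≤ g θ ↔ Q.eval θ ≤ 0) := by
    intro θ hθ
    obtain ⟨h₁, h₂⟩ := h θ hθ
    obtain ⟨h₁', h₂'⟩ := h' θ hθ
    have e : Q.eval θ = (f θ - g θ) * (D.eval θ * D'.eval θ) ^ 2 := by
      simp only [Q, Polynomial.eval_mul, Polynomial.eval_sub]
      rw [h₂, h₂']
      field_simp
    have hpos : 0 < (D.eval θ * D'.eval θ) ^ 2 := by positivity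
    rw [e, ← sub_nonpos]
    refine ⟨fun h3 => mul_nonpos_of_nonpos_of_nonneg h3 hpos.le, fun h3 => ?_⟩
    by_contra! h4
    exact absurd h3 (not_le.2 (mul_pos h4 hpos))
  refine ⟨Q.roots.toFinset, (card_roots_toFinset_le Q).trans ?_, fun θ hθ θ' hθ' hle hR => ?_⟩
  · refine Polynomial.natDegree_mul_le.trans ?_
    have h1 : (N * D' - N' * D).natDegree ≤ 2 * d := (Polynomial.natDegree_sub_le_of_le
      (natDegree_mul_le_two_mul hN hD') (natDegree_mul_le_two_mul hN' hD)).trans (max_self _).le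
    have h2 := natDegree_mul_le_two_mul hD hD'
    omega
  · rw [hQ θ hθ, hQ θ' hθ', eval_nonpos_iff_of_no_root hle hR]

/-- On `A`, the natural numbers in the memory do not depend on the parameter, and the reals are
rational functions of it of degree at most `d`. -/
structure IsRationalState (d : ℕ) (A : Set ℝ) (s : ℝ → State) : Prop where
  nat : ∀ θ ∈ A, ∀ θ' ∈ A, (s θ).nat = (s θ').nat
  natArr : ∀ θ ∈ A, ∀ θ' ∈ A, (s θ).natArr = (s θ').natArr
  real : ∀ k, IsRationalOn d A fun θ => (s θ).real k
  realArr : ∀ a i, IsRationalOn d A fun θ => (s θ).realArr a i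

namespace IsRationalState

theorem mono {d d' : ℕ} {A A' : Set ℝ} {s : ℝ → State} (h : IsRationalState d A s)
    (hd : d ≤ d') (hA : A' ⊆ A) : IsRationalState d' A' s where
  nat θ hθ θ' hθ' := h.nat θ (hA hθ) θ' (hA hθ')
  natArr θ hθ θ' hθ' := h.natArr θ (hA hθ) θ' (hA hθ')
  real k := (h.real k).mono hd hA
  realArr a i := (h.realArr a i).mono hd hA

theorem setReal {d : ℕ} {A : Set ℝ} {s : ℝ → State} (h : IsRationalState d A s) (k : ℕ)
    {v : ℝ → ℝ} (hv : IsRationalOn d A v) : IsRationalState d A fun θ => (s θ).setReal k (v θ) where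
  nat := h.nat
  natArr := h.natArr
  real j := by
    by_cases hj : j = k
    · subst hj; simpa [State.setReal] using hv
    · simpa [State.setReal, Function.update_of_ne hj] using h.real j
  realArr := h.realArr

theorem setNat {d : ℕ} {A : Set ℝ} {s : ℝ → State} (h : IsRationalState d A s) (k : ℕ)
    {v : ℝ → ℕ} (hv : ∀ θ ∈ A, ∀ θ' ∈ A, v θ = v θ') :
    IsRationalState d A fun θ => (s θ).setNat k (v θ) where
  nat θ hθ θ' hθ' := by simp only [State.setNat, h.nat θ hθ θ' hθ', hv θ hθ θ' hθ']
  natArr := h.natArr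
  real := h.real
  realArr := h.realArr

theorem apply_instr {d : ℕ} {A : Set ℝ} {s : ℝ → State} (h : IsRationalState d A s) (i : Instr) :
    ∃ R : Finset ℝ, R.card ≤ d ∧ IsRationalState (2 * d) (A \ R) fun θ => i.apply (s θ) := by
  have hd : d ≤ 2 * d := by omega
  have h2 : IsRationalState (2 * d) A s := h.mono hd le_rfl
  suffices hs : (∃ R : Finset ℝ, R.card ≤ d ∧
      IsRationalState (2 * d) (A \ R) fun θ => i.apply (s θ)) ∨
      IsRationalState (2 * d) A fun θ => i.apply (s θ) by
    rcases hs with hs | hs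
    · exact hs
    · exact ⟨∅, by simp, hs.mono le_rfl Set.sdiff_subset⟩
  have hn : ∀ k, ∀ θ ∈ A, ∀ θ' ∈ A, (s θ).nat k = (s θ').nat k := fun k θ hθ θ' hθ' => by
    rw [h.nat θ hθ θ' hθ']
  rcases A.eq_empty_or_nonempty with rfl | ⟨θ₀, hθ₀⟩
  · right
    refine ⟨by simp, by simp, fun k => ⟨0, 1, by simp, by simp, by simp⟩,
      fun a i => ⟨0, 1, by simp, by simp, by simp⟩⟩
  cases i with
  | natConst k v => exact .inr (h2.setNat k fun _ _ _ _ => rfl)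
  | natCopy k a => exact .inr (h2.setNat k (hn a))
  | natAdd k a b =>
    exact .inr (h2.setNat k fun θ hθ θ' hθ' => by rw [hn a θ hθ θ' hθ', hn b θ hθ θ' hθ'])
  | natSub k a b =>
    exact .inr (h2.setNat k fun θ hθ θ' hθ' => by rw [hn a θ hθ θ' hθ', hn b θ hθ θ' hθ'])
  | natHalf k a => exact .inr (h2.setNat k fun θ hθ θ' hθ' => by rw [hn a θ hθ θ' hθ'])
  | natLoad k arr idx =>
    exact .inr (h2.setNat k fun θ hθ θ' hθ' => by rw [hn idx θ hθ θ' hθ', h.natArr θ hθ θ' hθ'])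
  | natStore arr idx a =>
    refine .inr ⟨h2.nat, fun θ hθ θ' hθ' => ?_, h2.real, h2.realArr⟩
    simp only [Instr.apply, State.setNatArr, h.natArr θ hθ θ' hθ', hn idx θ hθ θ' hθ',
      hn a θ hθ θ' hθ']
  | toReal k a =>
    refine .inr (h2.setReal k ((isRationalOn_const _ _ ((s θ₀).nat a : ℝ)).congr fun θ hθ => ?_))
    rw [hn a θ hθ θ₀ hθ₀]
  | realCopy k a => exact .inr (h2.setReal k (h2.real a))
  | realAdd k a b => exact .inr (h2.setReal k ((h.real a).add (h.real b)))
  | realSub k a b => exact .inr (h2.setReal k ((h.real a).sub (h.real b)))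
  | realMul k a b => exact .inr (h2.setReal k ((h.real a).mul (h.real b)))
  | realDiv k a b =>
    obtain ⟨R, hR, hdiv⟩ := (h.real a).div (h.real b)
    exact .inl ⟨R, hR, (h2.mono le_rfl Set.sdiff_subset).setReal k hdiv⟩
  | realLoad k arr idx =>
    refine .inr (h2.setReal k ((h2.realArr arr ((s θ₀).nat idx)).congr fun θ hθ => ?_))
    rw [hn idx θ hθ θ₀ hθ₀]
  | realStore arr idx a =>
    refine .inr ⟨h2.nat, h2.natArr, h2.real, fun b j => ?_⟩
    by_cases hb : b = arr
    · subst hb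
      by_cases hj : j = (s θ₀).nat idx
      · refine (h2.real a).congr fun θ hθ => ?_
        simp [Instr.apply, State.setRealArr, hj, hn idx θ hθ θ₀ hθ₀]
      · refine (h2.realArr b j).congr fun θ hθ => ?_
        simp [Instr.apply, State.setRealArr, hn idx θ hθ θ₀ hθ₀, Function.update_of_ne hj]
    · refine (h2.realArr b j).congr fun θ hθ => ?_
      simp [Instr.apply, State.setRealArr, Function.update_of_ne hb]

theorem test_iff {d : ℕ} {A : Set ℝ} {s : ℝ → State} (h : IsRationalState d A s) (T : Test) :
    ∃ R : Finset ℝ, R.card ≤ 4 * d ∧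
      ∀ θ ∈ A, ∀ θ' ∈ A, θ ≤ θ' → (∀ r ∈ R, r ∉ Set.Icc θ θ') →
        (T.Holds (s θ) ↔ T.Holds (s θ')) := by
  cases T with
  | natLe a b =>
    refine ⟨∅, by simp, fun θ hθ θ' hθ' _ _ => ?_⟩
    simp only [Test.Holds, h.nat θ hθ θ' hθ']
  | realLe a b => exact (h.real a).le_iff (h.real b)

end IsRationalState

/-- The answer of a computation tree, as a function of the parameter, changes at no more than
`2 * d * 4 ^ depth` places: there are at most `2 ^ depth` nodes, and a value computed on the way
has degree at most `d * 2 ^ depth`. -/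
theorem ComputationTree.answer_changes_le (T : ComputationTree) :
    ∀ {d : ℕ} {A : Set ℝ} {s : ℝ → State}, 2 ≤ d → IsRationalState d A s →
    ∃ R : Finset ℝ, R.card ≤ 2 * d * 4 ^ T.depth ∧
      ∀ θ ∈ A, ∀ θ' ∈ A, θ ≤ θ' → (∀ r ∈ R, r ∉ Set.Icc θ θ') →
        (T.run θ (s θ)).map (fun u => u.nat 0) = (T.run θ' (s θ')).map (fun u => u.nat 0) := by
  classical
  induction T with
  | fail => intro d A s _ _; exact ⟨∅, by simp, by simp [run]⟩
  | leaf =>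
    intro d A s _ h
    refine ⟨∅, by simp, fun θ hθ θ' hθ' _ _ => ?_⟩
    simp [run, h.nat θ hθ θ' hθ']
  | act i T ih =>
    intro d A s hd h
    obtain ⟨R, hR, h'⟩ := h.apply_instr i
    obtain ⟨R', hR', hT⟩ := ih (by omega) h'
    refine ⟨R ∪ R', (Finset.card_union_le _ _).trans ?_, fun θ hθ θ' hθ' hle hr => ?_⟩
    · have : 1 ≤ 4 ^ T.depth := Nat.one_le_pow _ _ (by norm_num)
      have : d ≤ d * 4 ^ T.depth := Nat.le_mul_of_pos_right d this
      simp only [depth, pow_succ]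
      nlinarith
    · refine hT θ ⟨hθ, fun h1 => hr θ ?_ ⟨le_rfl, hle⟩⟩ θ' ⟨hθ', fun h1 => hr θ' ?_ ⟨hle, le_rfl⟩⟩
        hle fun r h1 => hr r (Finset.mem_union_right _ h1)
      · exact Finset.mem_union_left _ h1
      · exact Finset.mem_union_left _ h1
  | input k f hf T ih =>
    intro d A s hd h
    obtain ⟨R, hR, hT⟩ := ih hd (h.setReal k (isRationalOn_eval A (hf.trans hd)))
    refine ⟨R, hR.trans ?_, hT⟩
    simp only [depth, pow_succ]
    nlinarith [Nat.zero_le (d * 4 ^ T.depth)]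
  | branch T B B' ih ih' =>
    intro d A s hd h
    obtain ⟨R₀, hR₀, h₀⟩ := h.test_iff T
    obtain ⟨R, hR, hB⟩ := ih hd (h.mono le_rfl (Set.sep_subset A fun θ => T.Holds (s θ)))
    obtain ⟨R', hR', hB'⟩ := ih' hd (h.mono le_rfl (Set.sep_subset A fun θ => ¬ T.Holds (s θ)))
    refine ⟨R₀ ∪ (R ∪ R'), (Finset.card_union_le _ _).trans
      ((Nat.add_le_add_left (Finset.card_union_le _ _) _).trans ?_),
      fun θ hθ θ' hθ' hle hr => ?_⟩
    · set M := max B.depth B'.depth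
      have h1 : 4 ^ B.depth ≤ 4 ^ M := Nat.pow_le_pow_right (by norm_num) (le_max_left _ _)
      have h2 : 4 ^ B'.depth ≤ 4 ^ M := Nat.pow_le_pow_right (by norm_num) (le_max_right _ _)
      have h3 : 1 ≤ 4 ^ M := Nat.one_le_pow _ _ (by norm_num)
      have h4 := Nat.mul_le_mul_left (2 * d) h1
      have h5 := Nat.mul_le_mul_left (2 * d) h2
      have h6 := Nat.mul_le_mul_left (4 * d) h3
      simp only [depth, pow_succ]
      change _ ≤ 2 * d * (4 ^ M * 4)
      nlinarith
    · have h1 := h₀ θ hθ θ' hθ' hle fun r h1 => hr r (Finset.mem_union_left _ h1)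
      simp only [run]
      by_cases h2 : T.Holds (s θ)
      · rw [if_pos h2, if_pos (h1.1 h2)]
        exact hB θ ⟨hθ, h2⟩ θ' ⟨hθ', h1.1 h2⟩ hle fun r h3 => hr r
          (Finset.mem_union_right _ (Finset.mem_union_left _ h3))
      · rw [if_neg h2, if_neg (mt h1.2 h2)]
        exact hB' θ ⟨hθ, h2⟩ θ' ⟨hθ', mt h1.2 h2⟩ hle fun r h3 => hr r
          (Finset.mem_union_right _ (Finset.mem_union_right _ h3))

end RealRAM

/-! ### Vertices of the partial hulls -/

/-- A point of `S` at which a linear functional is larger than at all other points of `S` is a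
vertex of the convex hull of `S`. -/
theorem mem_extremePoints_convexHull_of_lt {S : Set (ℝ × ℝ)} {q : ℝ × ℝ} (hq : q ∈ S) (t : ℝ)
    (h : ∀ r ∈ S, r ≠ q → r.2 - q.2 < t * (r.1 - q.1)) :
    q ∈ (convexHull ℝ S).extremePoints ℝ := by
  set H : Set (ℝ × ℝ) := {r | r = q ∨ r.2 - q.2 < t * (r.1 - q.1)}
  have hH : Convex ℝ H := by
    intro r hr s hs a b ha hb hab
    by_cases hrq : r = q
    · by_cases hsq : s = q
      · left; rw [hrq, hsq, ← add_smul, hab, one_smul]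
      rcases hb.eq_or_lt with rfl | hb
      · left; simp only [add_zero] at hab; simp [hab, hrq]
      · right
        have h2 := hs.resolve_left hsq
        subst hrq
        simp only [Prod.fst_add, Prod.snd_add, Prod.smul_fst, Prod.smul_snd, smul_eq_mul]
        obtain rfl : a = 1 - b := by linarith
        nlinarith
    · have h1 := hr.resolve_left hrq
      rcases ha.eq_or_lt with rfl | ha
      · simp only [zero_add] at hab; simpa [hab] using hs
      right
      have h2 : s.2 - q.2 ≤ t * (s.1 - q.1) := by
        rcases hs with rfl | hs
        · simp
        · exact hs.le
      simp only [Prod.fst_add, Prod.snd_add, Prod.smul_fst, Prod.smul_snd, smul_eq_mul]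
      obtain rfl : b = 1 - a := by linarith
      nlinarith
  have hsub : convexHull ℝ S ⊆ H := convexHull_min (fun r hr => by
    by_cases hrq : r = q
    · exact .inl hrq
    · exact .inr (h r hr hrq)) hH
  rw [mem_extremePoints_iff_left]
  refine ⟨subset_convexHull ℝ S hq, fun r hr s hs hqrs => ?_⟩
  obtain ⟨a, b, ha, hb, hab, rfl⟩ := hqrs
  by_contra hne
  have h1 := (hsub hr).resolve_left hne
  have h2 : s.2 - (a • r + b • s).2 ≤ t * (s.1 - (a • r + b • s).1) := by
    rcases hsub hs with h2 | h2
    · rw [← h2]; simp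
    · exact h2.le
  simp only [Prod.fst_add, Prod.snd_add, Prod.smul_fst, Prod.smul_snd, smul_eq_mul] at h1 h2
  obtain rfl : b = 1 - a := by linarith
  nlinarith

theorem strictMono_injective_points {p : ℕ → ℝ × ℝ} (hp : StrictMono fun i => (p i).1) (c : ℝ) :
    Function.Injective fun i => ((p i).1, (p i).2 + c) := fun _ _ hij =>
  hp.injective (Prod.ext_iff.1 hij).1

/-- The lower endpoint of the `i`-th error segment is a vertex of the min hull if some line through
it lies strictly above all others. -/
theorem mem_minHullVertices {ε : ℝ} {p : ℕ → ℝ × ℝ} (hp : StrictMono fun i => (p i).1)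
    {n i : ℕ} (hi : i < n) (t : ℝ)
    (h : ∀ j < n, j ≠ i → (p j).2 - (p i).2 < t * ((p j).1 - (p i).1)) :
    ((p i).1, (p i).2 - ε) ∈ minHullVertices ε p n := by
  refine ⟨mem_extremePoints_convexHull_of_lt ⟨i, hi, rfl⟩ t ?_, ?_⟩
  · rintro _ ⟨j, hj, rfl⟩ hne
    have := h j hj (by rintro rfl; exact hne rfl)
    simpa using this
  · have h' : ∀ j < n, (p j).2 - (p i).2 ≤ t * ((p j).1 - (p i).1) := fun j hj => by
      by_cases hji : j = i
      · simp [hji]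
      · exact (h j hj hji).le
    have h0 := h' 0 (by omega)
    have h1 := h' (n - 1) (by omega)
    have m0 : (p 0).1 ≤ (p i).1 := hp.monotone (Nat.zero_le i)
    have m1 : (p i).1 ≤ (p (n - 1)).1 := hp.monotone (by omega)
    have e0 := mul_le_mul_of_nonneg_right h0 (sub_nonneg.2 m1)
    have e1 := mul_le_mul_of_nonneg_right h1 (sub_nonneg.2 m0)
    simp only [OnOrAbove]
    linarith

theorem minHullVertices_subset (ε : ℝ) (p : ℕ → ℝ × ℝ) (n : ℕ) :
    minHullVertices ε p n ⊆ lowerEndpoints ε p n := fun _ hq =>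
  extremePoints_convexHull_subset hq.1

theorem maxHullVertices_subset (ε : ℝ) (p : ℕ → ℝ × ℝ) (n : ℕ) :
    maxHullVertices ε p n ⊆ upperEndpoints ε p n := fun _ hq =>
  extremePoints_convexHull_subset hq.1

open Classical in
theorem ncard_minHullVertices {ε : ℝ} {p : ℕ → ℝ × ℝ} (hp : StrictMono fun i => (p i).1)
    (n : ℕ) : (minHullVertices ε p n).ncard =
      ((Finset.range n).filter fun i => ((p i).1, (p i).2 - ε) ∈ minHullVertices ε p n).card := by
  have : minHullVertices ε p n = (((Finset.range n).filter fun i =>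
      ((p i).1, (p i).2 - ε) ∈ minHullVertices ε p n).image
        fun i => ((p i).1, (p i).2 - ε) : Finset (ℝ × ℝ)) := by
    ext q
    simp only [Finset.coe_image, Finset.coe_filter, Finset.mem_range, Set.mem_image,
      Set.mem_ofPred_eq]
    constructor
    · intro hq
      obtain ⟨i, hi, rfl⟩ := minHullVertices_subset _ _ _ hq
      exact ⟨i, ⟨hi, hq⟩, rfl⟩
    · rintro ⟨i, ⟨_, hq⟩, rfl⟩
      exact hq
  conv_lhs => rw [this]
  rw [Set.ncard_coe_finset, Finset.card_image_of_injective]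
  exact strictMono_injective_points hp (-ε)

open Classical in
theorem ncard_maxHullVertices_le (ε : ℝ) (p : ℕ → ℝ × ℝ) (n : ℕ) :
    (maxHullVertices ε p n).ncard ≤
      ((Finset.range n).filter fun i => ((p i).1, (p i).2 + ε) ∈ maxHullVertices ε p n).card := by
  have : maxHullVertices ε p n = (((Finset.range n).filter fun i =>
      ((p i).1, (p i).2 + ε) ∈ maxHullVertices ε p n).image
        fun i => ((p i).1, (p i).2 + ε) : Finset (ℝ × ℝ)) := by
    ext q
    simp only [Finset.coe_image, Finset.coe_filter, Finset.mem_range, Set.mem_image,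
      Set.mem_ofPred_eq]
    constructor
    · intro hq
      obtain ⟨i, hi, rfl⟩ := maxHullVertices_subset _ _ _ hq
      exact ⟨i, ⟨hi, hq⟩, rfl⟩
    · rintro ⟨i, ⟨_, hq⟩, rfl⟩
      exact hq
  conv_lhs => rw [this]
  rw [Set.ncard_coe_finset]
  exact Finset.card_image_le

/-! ### Streams on which the tangent is hard to find -/

/-- The hard stream for the threshold `16 * K ^ 3 * δ`.  The lower endpoints of the first `K` error
segments lie on the parabola `y = δ * (1 - x ^ 2)`, at `x = -2 * K, …, -4, -2`.  They are followed
by a point far below, which is removed from the min hull as soon as the next point has arrived.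
The two points after it depend on the parameter `θ`: the upper endpoint at `x = 0` and the lower
endpoint at `x = 1` lie on the line `y = δ * (θ ^ 2 + 2 * θ * x)`. -/
noncomputable def hardStream (δ : ℝ) (K : ℕ) (θ : ℝ) (i : ℕ) : ℝ × ℝ :=
  if i < K then (-2 * ((K : ℝ) - i), δ * (1 - 4 * ((K : ℝ) - i) ^ 2) + 16 * K ^ 3 * δ)
  else ((i : ℝ) - (K + 1),
    if i = K then 8 * K ^ 2 * δ - 16 * K ^ 3 * δ
    else if i = K + 1 then δ * θ ^ 2 - 16 * K ^ 3 * δ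
    else if i = K + 2 then δ * (θ ^ 2 + 2 * θ) + 16 * K ^ 3 * δ
    else 0)

section HardStream

variable {δ : ℝ} {K : ℕ} {θ : ℝ}

theorem hardStream_of_lt {i : ℕ} (hi : i < K) : hardStream δ K θ i =
    (-2 * ((K : ℝ) - i), δ * (1 - 4 * ((K : ℝ) - i) ^ 2) + 16 * K ^ 3 * δ) := by
  simp [hardStream, hi]

theorem hardStream_low : hardStream δ K θ K = (-1, 8 * K ^ 2 * δ - 16 * K ^ 3 * δ) := by
  simp [hardStream]

theorem hardStream_upper :
    hardStream δ K θ (K + 1) = (0, δ * θ ^ 2 - 16 * K ^ 3 * δ) := by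
  simp [hardStream]

theorem hardStream_query :
    hardStream δ K θ (K + 2) = (1, δ * (θ ^ 2 + 2 * θ) + 16 * K ^ 3 * δ) := by
  simp [hardStream]; ring

theorem hardStream_eq_of_le {θ' : ℝ} {i : ℕ} (hi : i ≤ K) :
    hardStream δ K θ i = hardStream δ K θ' i := by
  rcases hi.lt_or_eq with hi | rfl
  · rw [hardStream_of_lt hi, hardStream_of_lt hi]
  · rw [hardStream_low, hardStream_low]

theorem hardStream_strictMono : StrictMono fun i => (hardStream δ K θ i).1 := by
  refine strictMono_nat_of_lt_succ fun i => ?_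
  rcases lt_trichotomy (i + 1) K with h | h | h
  · rw [hardStream_of_lt h, hardStream_of_lt (by omega : i < K)]
    push_cast; linarith
  · subst h
    rw [hardStream_low, hardStream_of_lt (Nat.lt_succ_self i)]
    push_cast; linarith
  · have h1 : ¬ i < K := by omega
    have h2 : ¬ i + 1 < K := by omega
    simp only [hardStream, if_neg h1, if_neg h2]
    push_cast; linarith

theorem exists_sub_eq {i : ℕ} (hi : i < K) :
    ∃ k : ℝ, (K : ℝ) - i = k ∧ 1 ≤ k ∧ k ≤ K := by
  refine ⟨_, rfl, ?_, by simp⟩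
  have : (i : ℝ) + 1 ≤ K := by exact_mod_cast hi
  linarith

/-- The line `y = δ * (θ' ^ 2 + 2 * θ' * x)` is valid for the points before the query if `θ'` is odd
and its value at `x = 0` fits. -/
theorem hardStream_line_valid (hδ : 0 < δ) (hK : 2 ≤ K) (hθ : 1 ≤ θ) (hθK : θ ≤ 2 * K) (m : ℕ)
    (hm : (2 * m + 1 : ℝ) ≤ θ) {i : ℕ} (hi : i < K + 2) :
    |(hardStream δ K θ i).2 - (δ * (2 * (2 * m + 1)) * (hardStream δ K θ i).1 +
      δ * (2 * m + 1) ^ 2)| ≤ 16 * K ^ 3 * δ := by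
  have hK' : (2 : ℝ) ≤ K := by exact_mod_cast hK
  have hK2 : (K : ℝ) ^ 2 * 2 ≤ K ^ 3 := by nlinarith [sq_nonneg (K : ℝ)]
  have hK1 : (K : ℝ) * 2 ≤ K ^ 2 := by nlinarith
  have hm0 : (0 : ℝ) ≤ m := m.cast_nonneg
  rcases lt_trichotomy i K with h | rfl | h
  · rw [hardStream_of_lt h]
    -- Only here is it used that `2 * m + 1` is odd.
    have hodd : (1 : ℝ) ≤ (2 * ((K : ℝ) - i) - (2 * m + 1)) ^ 2 := by
      have h1 : (1 : ℤ) ≤ (2 * ((K : ℤ) - i) - (2 * m + 1)) ^ 2 := by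
        have h2 : (2 * ((K : ℤ) - i) - (2 * m + 1)) ≠ 0 := by omega
        have := sq_pos_of_ne_zero h2
        omega
      exact_mod_cast h1
    obtain ⟨k, hk, hk1, hkK⟩ := exists_sub_eq h
    rw [hk] at hodd ⊢
    have h2 : (2 * k - (2 * m + 1)) ^ 2 ≤ 4 * (K : ℝ) ^ 2 := by
      have : (2 * k - (2 * m + 1)) ^ 2 ≤ (2 * (K : ℝ)) ^ 2 :=
        sq_le_sq' (by linarith) (by linarith)
      linarith
    rw [abs_le]
    constructor
    · have := mul_nonneg hδ.le (by linarith :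
        0 ≤ 32 * (K : ℝ) ^ 3 + 1 - (2 * k - (2 * m + 1)) ^ 2)
      linarith
    · have := mul_nonneg hδ.le (sub_nonneg.2 hodd)
      linarith
  · rw [hardStream_low]
    have h2 : (2 * m + 1 : ℝ) ^ 2 ≤ 4 * (i : ℝ) ^ 2 := by nlinarith
    rw [abs_le]
    constructor
    · have := mul_nonneg hδ.le (by nlinarith :
        0 ≤ 8 * (i : ℝ) ^ 2 - (2 * m + 1) ^ 2 + 2 * (2 * m + 1))
      linarith
    · have := mul_nonneg hδ.le (by nlinarith :
        0 ≤ 32 * (i : ℝ) ^ 3 - 8 * (i : ℝ) ^ 2 + (2 * m + 1) ^ 2 - 2 * (2 * m + 1))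
      linarith
  · obtain rfl : i = K + 1 := by omega
    rw [hardStream_upper]
    have h2 : θ ^ 2 ≤ 4 * (K : ℝ) ^ 2 := by nlinarith
    have h3 : (2 * m + 1 : ℝ) ^ 2 ≤ θ ^ 2 := by nlinarith
    rw [abs_le]
    constructor
    · have := mul_nonneg hδ.le (by linarith : 0 ≤ θ ^ 2 - (2 * m + 1) ^ 2)
      linarith
    · have := mul_nonneg hδ.le (by nlinarith :
        0 ≤ 32 * (K : ℝ) ^ 3 - θ ^ 2 + (2 * m + 1) ^ 2)
      linarith

theorem hardStream_hasValidLine (hδ : 0 < δ) (hK : 2 ≤ K) (hθ : 1 ≤ θ) (hθK : θ ≤ 2 * K) {n : ℕ}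
    (hn : n ≤ K + 2) : HasValidLine (16 * K ^ 3 * δ) (hardStream δ K θ) n :=
  ⟨_, _, fun i hi => hardStream_line_valid hδ hK hθ hθK 0 (by simpa using hθ)
    (by omega : i < K + 2)⟩

theorem hardStream_hasValidLine_query (hδ : 0 < δ) (hK : 2 ≤ K) {m : ℕ} (hmK : m < K) :
    HasValidLine (16 * K ^ 3 * δ) (hardStream δ K (2 * m + 1 : ℕ)) (K + 3) := by
  have hmK' : (m : ℝ) + 1 ≤ K := by exact_mod_cast hmK
  have hm0 : (0 : ℝ) ≤ m := m.cast_nonneg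
  refine ⟨δ * (2 * (2 * m + 1)), δ * (2 * m + 1) ^ 2, fun i hi => ?_⟩
  rcases Nat.lt_succ_iff_lt_or_eq.1 hi with h | rfl
  · exact hardStream_line_valid hδ hK (by push_cast; linarith) (by push_cast; linarith) m
      (by push_cast; linarith) h
  · rw [hardStream_query]
    push_cast
    have : (0 : ℝ) ≤ 16 * K ^ 3 * δ := by positivity
    rw [abs_le]
    constructor <;> linarith

theorem hardStream_not_hasValidLine_query (hδ : 0 < δ) {m : ℕ} (hm : 1 ≤ m)
    (hmK : m ≤ K) : ¬ HasValidLine (16 * K ^ 3 * δ) (hardStream δ K (2 * m : ℕ)) (K + 3) := by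
  rintro ⟨a, b, hab⟩
  have h1 := (abs_le.1 (hab (K - m) (by omega))).2
  have h2 := (abs_le.1 (hab (K + 1) (by omega))).1
  have h3 := (abs_le.1 (hab (K + 2) (by omega))).2
  rw [hardStream_of_lt (by omega : K - m < K), Nat.cast_sub hmK, sub_sub_cancel] at h1
  rw [hardStream_upper] at h2
  rw [hardStream_query] at h3
  push_cast at h1 h2 h3
  have hm' : (1 : ℝ) ≤ m := by exact_mod_cast hm
  have h4 : 4 * δ * m ≤ a := by linarith
  have h5 := mul_le_mul_of_nonneg_left h4 (by linarith : (0 : ℝ) ≤ m)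
  nlinarith

theorem hardStream_mem_minHull_of_lt (hδ : 0 < δ) (hK : 2 ≤ K) (hθ : 1 ≤ θ) (hθK : θ ≤ 2 * K)
    {n i : ℕ} (hn : K + 1 ≤ n) (hnK : n ≤ K + 2) (hi : i < K) :
    ((hardStream δ K θ i).1, (hardStream δ K θ i).2 - 16 * K ^ 3 * δ) ∈
      minHullVertices (16 * K ^ 3 * δ) (hardStream δ K θ) n := by
  have hK' : (2 : ℝ) ≤ K := by exact_mod_cast hK
  have hK2 : (K : ℝ) ^ 2 * 2 ≤ K ^ 3 := by nlinarith [sq_nonneg (K : ℝ)]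
  have hK1 : (K : ℝ) * 2 ≤ K ^ 2 := by nlinarith
  -- The tangent of the parabola.
  refine mem_minHullVertices hardStream_strictMono (by omega) (4 * δ * ((K : ℝ) - i))
    fun j hj hji => ?_
  rw [hardStream_of_lt hi]
  obtain ⟨k, hk, hk1, hkK⟩ := exists_sub_eq hi
  rcases lt_trichotomy j K with h | rfl | h
  · rw [hardStream_of_lt h]
    have h1 : (0 : ℝ) < ((i : ℝ) - j) ^ 2 := by
      have : (i : ℝ) ≠ j := by exact_mod_cast hji.symm
      have := sub_ne_zero.2 this
      positivity
    have := mul_pos hδ h1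
    simp only
    nlinarith
  · rw [hardStream_low, hk]
    have := mul_pos hδ (by nlinarith : 0 < 32 * (j : ℝ) ^ 3 - 8 * (j : ℝ) ^ 2 + 1 + 4 * k ^ 2 - 4 * k)
    simp only
    linarith
  · obtain rfl : j = K + 1 := by omega
    rw [hardStream_upper, hk]
    have := mul_pos hδ (by nlinarith : 0 < 32 * (K : ℝ) ^ 3 - θ ^ 2 + 1 + 4 * k ^ 2)
    simp only
    linarith

theorem hardStream_mem_minHull_last (hδ : 0 < δ) (hK : 2 ≤ K)
    {i : ℕ} (hi : K ≤ i) (hiK : i ≤ K + 1) :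
    ((hardStream δ K θ i).1, (hardStream δ K θ i).2 - 16 * K ^ 3 * δ) ∈
      minHullVertices (16 * K ^ 3 * δ) (hardStream δ K θ) (i + 1) := by
  have hK' : (2 : ℝ) ≤ K := by exact_mod_cast hK
  have hK2 : (K : ℝ) ^ 2 * 2 ≤ K ^ 3 := by nlinarith [sq_nonneg (K : ℝ)]
  -- Any slope that is steep enough will do.
  refine mem_minHullVertices hardStream_strictMono (Nat.lt_succ_self i)
    (-(δ * (32 * K ^ 3 + 1))) fun j hj hji => ?_
  have hpos := mul_pos hδ (by nlinarith : 0 < 32 * (K : ℝ) ^ 3 + 1)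
  rcases lt_trichotomy j K with h | rfl | h
  · rw [hardStream_of_lt h]
    obtain ⟨k, hk, hk1, hkK⟩ := exists_sub_eq h
    rw [hk]
    have h1 := mul_le_mul_of_nonneg_left hk1 hpos.le
    rcases hi.eq_or_lt with rfl | hi
    · rw [hardStream_low]
      have h2 := mul_pos hδ (by nlinarith : 0 < 4 * k ^ 2 + 8 * (K : ℝ) ^ 2)
      simp only
      linarith
    · obtain rfl : i = K + 1 := by omega
      rw [hardStream_upper]
      have h2 := mul_pos hδ (by nlinarith : 0 < 4 * k ^ 2 + θ ^ 2)
      simp only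
      linarith
  · obtain rfl : i = j + 1 := by omega
    rw [hardStream_low, hardStream_upper]
    have h2 := mul_pos hδ (by nlinarith [sq_nonneg θ] : 0 < 32 * (j : ℝ) ^ 3 + 1 - 8 * j ^ 2 + θ ^ 2)
    simp only
    linarith
  · omega

theorem hullSize_hardStream_low (hδ : 0 < δ) (hK : 2 ≤ K) (hθ : 1 ≤ θ) (hθK : θ ≤ 2 * K) :
    hullSize (16 * K ^ 3 * δ) (hardStream δ K θ) (K + 1) = K + 1 := by
  classical
  unfold hullSize
  rw [ncard_minHullVertices hardStream_strictMono, Finset.filter_true_of_mem, Finset.card_range]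
  · refine max_eq_left ((ncard_maxHullVertices_le _ _ _).trans ?_)
    exact (Finset.card_filter_le _ _).trans (Finset.card_range _).le
  · intro i hi
    rcases (Nat.lt_succ_iff.1 (Finset.mem_range.1 hi)).lt_or_eq with h | rfl
    · exact hardStream_mem_minHull_of_lt hδ hK hθ hθK le_rfl (by omega) h
    · exact hardStream_mem_minHull_last hδ hK le_rfl (by omega)

theorem hullSize_hardStream_upper (hδ : 0 < δ) (hK : 2 ≤ K) (hθ : 1 ≤ θ) (hθK : θ ≤ 2 * K) :
    hullSize (16 * K ^ 3 * δ) (hardStream δ K θ) (K + 2) = K + 1 := by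
  classical
  have hK' : (2 : ℝ) ≤ K := by exact_mod_cast hK
  have hK2 : (K : ℝ) ^ 2 * 2 ≤ K ^ 3 := by nlinarith [sq_nonneg (K : ℝ)]
  unfold hullSize
  have hmin : ((Finset.range (K + 2)).filter fun i =>
      ((hardStream δ K θ i).1, (hardStream δ K θ i).2 - 16 * K ^ 3 * δ) ∈
        minHullVertices (16 * K ^ 3 * δ) (hardStream δ K θ) (K + 2)) =
      (Finset.range (K + 2)).erase K := by
    ext i
    simp only [Finset.mem_filter, Finset.mem_erase, Finset.mem_range]
    constructor
    · rintro ⟨hi, hmem⟩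
      refine ⟨?_, hi⟩
      rintro rfl
      -- The low point is below the chord from the first to the last point.
      have h := hmem.2
      simp only [OnOrAbove] at h
      rw [hardStream_of_lt (by omega : 0 < i), hardStream_low,
        (by omega : i + 2 - 1 = i + 1), hardStream_upper] at h
      push_cast at h
      simp only [sub_zero] at h
      have h1 := mul_pos hδ (by nlinarith : 0 < (θ ^ 2 - 1 + 4 * (i : ℝ) ^ 2) * (2 * i - 1) +
        8 * (i : ℝ) ^ 3 + 2 * i)
      linarith
    · rintro ⟨hne, hi⟩
      refine ⟨hi, ?_⟩
      by_cases h : i < K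
      · exact hardStream_mem_minHull_of_lt hδ hK hθ hθK (by omega) le_rfl h
      · obtain rfl : i = K + 1 := by omega
        exact hardStream_mem_minHull_last hδ hK (by omega) le_rfl
  have hmax : ((Finset.range (K + 2)).filter fun i =>
      ((hardStream δ K θ i).1, (hardStream δ K θ i).2 + 16 * K ^ 3 * δ) ∈
        maxHullVertices (16 * K ^ 3 * δ) (hardStream δ K θ) (K + 2)) ⊆
      (Finset.range (K + 2)).erase (K - 1) := by
    intro i
    simp only [Finset.mem_filter, Finset.mem_erase, Finset.mem_range]
    rintro ⟨hi, hmem⟩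
    refine ⟨?_, hi⟩
    rintro rfl
    -- This upper endpoint is above the chord from the first to the last one.
    have h := hmem.2
    simp only [OnOrBelow] at h
    rw [hardStream_of_lt (by omega : 0 < K), hardStream_of_lt (by omega : K - 1 < K),
      (by omega : K + 2 - 1 = K + 1), hardStream_upper, Nat.cast_sub (by omega)] at h
    push_cast at h
    simp only [sub_zero, sub_sub_cancel] at h
    have h2 : θ ^ 2 ≤ 4 * (K : ℝ) ^ 2 := by nlinarith
    have h3 : 0 ≤ (32 * (K : ℝ) ^ 3 + 1 - 4 * K ^ 2 - θ ^ 2) * (2 * K - 2) :=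
      mul_nonneg (by nlinarith) (by linarith)
    have h1 := mul_pos hδ (by nlinarith :
      0 < (32 * (K : ℝ) ^ 3 + 1 - 4 * K ^ 2 - θ ^ 2) * (2 * K - 2) + (4 * (K : ℝ) ^ 2 - 4) * (2 * K))
    linarith
  have hcard : ((Finset.range (K + 2)).erase K).card = K + 1 := by
    rw [Finset.card_erase_of_mem (by simp), Finset.card_range]; omega
  have hcard' : ((Finset.range (K + 2)).erase (K - 1)).card = K + 1 := by
    rw [Finset.card_erase_of_mem (by simp; omega), Finset.card_range]; omega
  rw [ncard_minHullVertices hardStream_strictMono, hmin, hcard]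
  refine max_eq_left ((ncard_maxHullVertices_le _ _ _).trans ?_)
  exact (Finset.card_le_card hmax).trans hcard'.le

end HardStream

/-! ### The lower bound -/

namespace RealRAM

open ComputationTree

/-- Two consecutive points of the stream are processed in at most `t` steps each, which is followed
by a computation tree; the first point is in the memory already. -/
noncomputable def twoRoundTree (P : Program) (t : ℕ) (x : ℝ) (f : Polynomial ℝ)
    (hf : f.natDegree ≤ 2) : ComputationTree :=
  P.tree (fun _ => .input 0 (.C x) (by simp) (.input 1 f hf (P.tree (fun _ => .leaf) t))) t

theorem depth_twoRoundTree_le (P : Program) (t : ℕ) (x : ℝ) (f : Polynomial ℝ)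
    (hf : f.natDegree ≤ 2) : (twoRoundTree P t x f hf).depth ≤ 2 * t + 2 := by
  have h1 := P.depth_tree_le (fun _ => .leaf) 0 (fun m => by simp [depth]) t
  refine (P.depth_tree_le _ (t + 2) (fun m => ?_) t).trans (by omega)
  simp only [depth]
  omega

theorem run_twoRoundTree {P : Program} {t : ℕ} {x : ℝ} {f : Polynomial ℝ}
    {hf : f.natDegree ≤ 2} {θ : ℝ} {s s' s'' : State} {t₁ t₂ : ℕ} (h₁ : Exec P s t₁ s')
    (ht₁ : t₁ ≤ t) (h₂ : Exec P (s'.feed (x, f.eval θ)) t₂ s'') (ht₂ : t₂ ≤ t) :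
    (twoRoundTree P t x f hf).run θ s = some s'' := by
  obtain ⟨m, rfl⟩ := Nat.exists_eq_add_of_le ht₁
  obtain ⟨m', hm'⟩ := Nat.exists_eq_add_of_le ht₂
  have e := P.run_tree θ h₂ (fun _ => .leaf) m'
  rw [← hm'] at e
  rw [twoRoundTree, P.run_tree θ h₁]
  simp only [run, Polynomial.eval_C]
  exact e

/-- If on all the hard streams the points at `x = 0` and `x = 1` are processed in at most `t` steps,
then there are few vertices: the answer changes between `2 * m` and `2 * m + 1` for all `m`. -/
theorem card_le_of_time_le {P : Program} {K t : ℕ} {δ : ℝ} (hδ : 0 < δ) (hK : 2 ≤ K)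
    (hP : DecidesValidLine P (16 * K ^ 3 * δ))
    (ht : ∀ θ : ℝ, 1 ≤ θ → θ ≤ 2 * K → ∀ σ τ, IsRun P (16 * K ^ 3 * δ) (hardStream δ K θ) σ τ →
      τ (K + 1) ≤ t ∧ τ (K + 2) ≤ t) : K - 1 ≤ 4 * 4 ^ (2 * t + 2) := by
  choose σ τ hrun hyes using fun θ => hP (hardStream δ K θ) hardStream_strictMono
  set f : Polynomial ℝ := .C δ * .X ^ 2 - .C (16 * K ^ 3 * δ)
  set g : Polynomial ℝ := .C δ * (.X ^ 2 + 2 * .X) + .C (16 * K ^ 3 * δ)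
  have hf : f.natDegree ≤ 2 := by simp only [f]; compute_degree
  have hg : g.natDegree ≤ 2 := by simp only [g]; compute_degree
  set T := twoRoundTree P t 1 g hg
  set s : ℝ → State := fun θ => (σ 0 (K + 1)).feed (0, f.eval θ)
  have hs : IsRationalState 2 Set.univ s := by
    have h0 : IsRationalState 2 Set.univ fun _ => σ 0 (K + 1) :=
      ⟨fun _ _ _ _ => rfl, fun _ _ _ _ => rfl, fun k => isRationalOn_const _ _ _,
        fun a i => isRationalOn_const _ _ _⟩
    exact (h0.setReal 0 (isRationalOn_const _ _ 0)).setReal 1 (isRationalOn_eval _ hf)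
  have hT : ∀ θ : ℝ, 1 ≤ θ → θ ≤ 2 * K → T.run θ (s θ) = some (σ θ (K + 3)) := by
    intro θ h1 h2
    obtain ⟨ht₁, ht₂⟩ := ht θ h1 h2 _ _ (hrun θ)
    have e₁ := (hrun θ).2 (K + 1)
    have e₂ := (hrun θ).2 (K + 2)
    rw [(hrun θ).state_eq (hrun 0) fun i hi => hardStream_eq_of_le (by omega),
      hardStream_upper] at e₁
    rw [hardStream_query] at e₂
    have ef : f.eval θ = δ * θ ^ 2 - 16 * K ^ 3 * δ := by simp [f]
    have eg : g.eval θ = δ * (θ ^ 2 + 2 * θ) + 16 * K ^ 3 * δ := by simp [g]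
    rw [← ef] at e₁
    rw [← eg] at e₂
    exact run_twoRoundTree e₁ ht₁ e₂ ht₂
  obtain ⟨R, hR, hch⟩ := T.answer_changes_le le_rfl hs
  have hroot : ∀ m : ℕ, m < K - 1 →
      ∃ r ∈ R, r ∈ Set.Icc ((2 * (m + 1) : ℕ) : ℝ) ((2 * (m + 1) + 1 : ℕ) : ℝ) := by
    intro m hm
    by_contra! hcon
    have hmK : (m : ℝ) + 2 ≤ K := by exact_mod_cast (by omega : m + 2 ≤ K)
    have hm0 : (0 : ℝ) ≤ m := m.cast_nonneg
    have e := hch _ trivial _ trivial (by push_cast; linarith) hcon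
    rw [hT _ (by push_cast; linarith) (by push_cast; linarith),
      hT _ (by push_cast; linarith) (by push_cast; linarith)] at e
    have e' := Option.some.inj e
    have y1 := (hyes ((2 * (m + 1) : ℕ) : ℝ) (K + 2)).not.2
      (hardStream_not_hasValidLine_query hδ (by omega) (by omega))
    have y2 := (hyes ((2 * (m + 1) + 1 : ℕ) : ℝ) (K + 2)).2
      (hardStream_hasValidLine_query hδ hK (by omega))
    exact y1 (e'.trans y2)
  choose! r hrR hr using hroot
  calc K - 1 = (Finset.range (K - 1)).card := (Finset.card_range _).symm
    _ ≤ R.card := by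
      refine Finset.card_le_card_of_injOn r (fun m hm => hrR m (by simpa using hm)) ?_
      intro m hm m' hm' hmm
      have h1 := hr m (by simpa using hm)
      have h2 := hr m' (by simpa using hm')
      rw [hmm] at h1
      have h3 := h1.1.trans h2.2
      have h4 := h2.1.trans h1.2
      norm_cast at h3 h4
      omega
    _ ≤ 2 * 2 * 4 ^ T.depth := hR
    _ ≤ 4 * 4 ^ (2 * t + 2) := Nat.mul_le_mul_left 4
      (Nat.pow_le_pow_right (by norm_num) (depth_twoRoundTree_le P t 1 g hg))

theorem lower_bound {ε : ℝ} (hε : 0 < ε) {P : Program} (hP : DecidesValidLine P ε) {h : ℕ}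
    (hh : 5000 ≤ h) :
    ∃ (p : ℕ → ℝ × ℝ) (n : ℕ), StrictMono (fun i => (p i).1) ∧
      HasValidLine ε p n ∧ hullSize ε p n = h ∧
      ∀ (σ : ℕ → State) (τ : ℕ → ℕ), IsRun P ε p σ τ → 1 / 6 * Real.log h ≤ (τ n : ℝ) := by
  obtain ⟨K, rfl⟩ : ∃ K, h = K + 1 := ⟨h - 1, by omega⟩
  have hK : 2 ≤ K := by omega
  have hK0 : (0 : ℝ) < K := by exact_mod_cast (by omega : 0 < K)
  obtain ⟨δ, hδ, rfl⟩ : ∃ δ : ℝ, 0 < δ ∧ ε = 16 * K ^ 3 * δ :=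
    ⟨ε / (16 * K ^ 3), by positivity, by field_simp⟩
  by_contra! hcon
  have hfast : ∀ θ : ℝ, 1 ≤ θ → θ ≤ 2 * K →
      ∀ σ τ, IsRun P (16 * K ^ 3 * δ) (hardStream δ K θ) σ τ →
      τ (K + 1) ≤ ⌊1 / 6 * Real.log (K + 1 : ℕ)⌋₊ ∧
        τ (K + 2) ≤ ⌊1 / 6 * Real.log (K + 1 : ℕ)⌋₊ := by
    intro θ h1 h2 σ τ hrun
    constructor
    · obtain ⟨σ', τ', hrun', hlt⟩ := hcon (hardStream δ K θ) (K + 1) hardStream_strictMono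
        (hardStream_hasValidLine hδ hK h1 h2 (by omega)) (hullSize_hardStream_low hδ hK h1 h2)
      rw [hrun.time_eq hrun']
      exact Nat.le_floor hlt.le
    · obtain ⟨σ', τ', hrun', hlt⟩ := hcon (hardStream δ K θ) (K + 2) hardStream_strictMono
        (hardStream_hasValidLine hδ hK h1 h2 (by omega)) (hullSize_hardStream_upper hδ hK h1 h2)
      rw [hrun.time_eq hrun']
      exact Nat.le_floor hlt.le
  have hcard := card_le_of_time_le hδ hK hP hfast
  set t := ⌊1 / 6 * Real.log (K + 1 : ℕ)⌋₊
  have hH : (5000 : ℝ) ≤ (K + 1 : ℕ) := by exact_mod_cast hh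
  set H : ℝ := ((K + 1 : ℕ) : ℝ)
  have hlog : 0 ≤ Real.log H := Real.log_nonneg (by linarith)
  have ht : (t : ℝ) ≤ 1 / 6 * Real.log H := Nat.floor_le (by positivity)
  -- `16 ^ t ≤ √H` because `log 16 ≤ 3`.
  have h16 : (16 : ℝ) ^ t ≤ √H := by
    have h1 : Real.log 16 ≤ 3 := by
      have : (16 : ℝ) = 2 ^ 4 := by norm_num
      rw [this, Real.log_pow]
      have := Real.log_two_lt_d9
      push_cast
      linarith
    rw [← Real.log_le_log_iff (by positivity) (Real.sqrt_pos.2 (by linarith)), Real.log_pow,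
      Real.log_sqrt (by linarith)]
    have := mul_le_mul_of_nonneg_left h1 t.cast_nonneg
    linarith
  have hcard' : H - 2 ≤ 64 * 16 ^ t := by
    have h1 : (4 : ℕ) * 4 ^ (2 * t + 2) = 64 * 16 ^ t := by
      rw [pow_add, pow_mul]; norm_num; ring
    rw [h1] at hcard
    have h2 : K + 1 ≤ 64 * 16 ^ t + 2 := by omega
    have h3 : H ≤ 64 * 16 ^ t + 2 := by
      simp only [H]
      exact_mod_cast h2
    linarith
  have hsq := Real.sq_sqrt (by linarith : 0 ≤ H)
  have h70 : 70 ≤ √H := Real.le_sqrt_of_sq_le (by norm_num; linarith)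
  have h71 := mul_le_mul_of_nonneg_left h70 (Real.sqrt_nonneg H)
  linarith

end RealRAM

/-! ### Valid lines and slopes -/

/-- The stream, reflected at the horizontal axis; it turns the max hull into the min hull. -/
def reflect (p : ℕ → ℝ × ℝ) (i : ℕ) : ℝ × ℝ := ((p i).1, -(p i).2)

/-- The slope `a` is at most the slope of every segment from a lower endpoint to a later upper
endpoint of the first `n` points. -/
def SlopeLe (ε : ℝ) (q : ℕ → ℝ × ℝ) (n : ℕ) (a : ℝ) : Prop :=
  ∀ j < n, ∀ i < j, a * ((q j).1 - (q i).1) ≤ (q j).2 - (q i).2 + 2 * ε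

/-- The intercept can be eliminated: for a given slope the segments confine it to intervals, and
these have a common point if any two of them do. -/
theorem hasValidLine_iff_exists_slope {ε : ℝ} (hε : 0 ≤ ε) (p : ℕ → ℝ × ℝ) (n : ℕ) :
    HasValidLine ε p n ↔ ∃ a, SlopeLe ε p n a ∧ SlopeLe ε (reflect p) n (-a) := by
  constructor
  · rintro ⟨a, b, h⟩
    refine ⟨a, fun j hj i hi => ?_, fun j hj i hi => ?_⟩
    · linarith [(abs_le.1 (h i (hi.trans hj))).2, (abs_le.1 (h j hj)).1]
    · simp only [reflect]
      linarith [(abs_le.1 (h i (hi.trans hj))).1, (abs_le.1 (h j hj)).2]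
  · rintro ⟨a, h1, h2⟩
    rcases Nat.eq_zero_or_pos n with rfl | hn
    · exact ⟨0, 0, fun i hi => absurd hi (Nat.not_lt_zero i)⟩
    obtain ⟨m, hm, hmax⟩ := Finset.exists_max_image (Finset.range n)
      (fun i => (p i).2 - a * (p i).1) ⟨0, by simpa using hn⟩
    rw [Finset.mem_range] at hm
    refine ⟨a, (p m).2 - a * (p m).1 - ε, fun i hi => ?_⟩
    have h3 := hmax i (Finset.mem_range.2 hi)
    rw [abs_le]
    refine ⟨?_, by linarith⟩
    rcases lt_trichotomy m i with h | rfl | h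
    · linarith [h1 i hi m h]
    · linarith
    · have := h2 m hm i h
      simp only [reflect] at this
      linarith

theorem ncard_minHullVertices_reflect (ε : ℝ) (p : ℕ → ℝ × ℝ) (n : ℕ) :
    (minHullVertices ε (reflect p) n).ncard = (maxHullVertices ε p n).ncard := by
  set e : (ℝ × ℝ) ≃ₗ[ℝ] (ℝ × ℝ) := (LinearEquiv.refl ℝ ℝ).prodCongr (LinearEquiv.neg ℝ)
  have he : ∀ q : ℝ × ℝ, e q = (q.1, -q.2) := fun q => rfl
  have hend : lowerEndpoints ε (reflect p) n = e '' upperEndpoints ε p n := by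
    ext q
    constructor
    · rintro ⟨i, hi, rfl⟩
      exact ⟨_, ⟨i, hi, rfl⟩, by rw [he]; simp only [reflect]; congr 1; ring⟩
    · rintro ⟨_, ⟨i, hi, rfl⟩, rfl⟩
      exact ⟨i, hi, by rw [he]; simp only [reflect]; congr 1; ring⟩
  have hhull : convexHull ℝ (lowerEndpoints ε (reflect p) n) =
      e '' convexHull ℝ (upperEndpoints ε p n) := by
    rw [hend]
    exact (LinearMap.image_convexHull (e : (ℝ × ℝ) →ₗ[ℝ] (ℝ × ℝ)) _).symm
  have : minHullVertices ε (reflect p) n = e '' maxHullVertices ε p n := by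
    ext q
    simp only [minHullVertices, maxHullVertices, hhull, ← image_extremePoints, Set.mem_image]
    have key : ∀ r : ℝ × ℝ, OnOrAbove (((reflect p) 0).1, ((reflect p) 0).2 - ε)
        (((reflect p) (n - 1)).1, ((reflect p) (n - 1)).2 - ε) (e r) ↔
        OnOrBelow ((p 0).1, (p 0).2 + ε) ((p (n - 1)).1, (p (n - 1)).2 + ε) r := by
      intro r
      rw [he]
      simp only [OnOrAbove, OnOrBelow, reflect]
      constructor <;> intro h <;> linarith
    constructor
    · rintro ⟨⟨r, hr, rfl⟩, h⟩
      exact ⟨r, ⟨hr, (key r).1 h⟩, rfl⟩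
    · rintro ⟨r, ⟨hr, h⟩, rfl⟩
      exact ⟨⟨r, hr, rfl⟩, (key r).2 h⟩
  rw [this, Set.ncard_image_of_injective _ e.injective]

/-! ### The min hull as a chain -/

/-- The point `(x, y)` lies strictly below the line through the vertices `i` and `i + 1`. -/
def BelowEdge (X Y : ℕ → ℝ) (i : ℕ) (x y : ℝ) : Prop :=
  (y - Y i) * (X (i + 1) - X i) < (Y (i + 1) - Y i) * (x - X i)

/-- The points `(X i, Y i)`, `i < k`, are the vertices of the min hull of the first `n` points, from
left to right: a strictly concave chain of lower endpoints from the first to the last one, such that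
no lower endpoint is above the line through one of its edges. -/
structure IsHullChain (ε : ℝ) (q : ℕ → ℝ × ℝ) (n k : ℕ) (X Y : ℕ → ℝ) : Prop where
  pos : 1 ≤ k
  first : X 0 = (q 0).1
  last : X (k - 1) = (q (n - 1)).1
  mem : ∀ i < k, ∃ j < n, X i = (q j).1 ∧ Y i = (q j).2 - ε
  lt : ∀ i, i + 1 < k → X i < X (i + 1)
  below : ∀ i, i + 1 < k → ∀ j < n,
    ((q j).2 - ε - Y i) * (X (i + 1) - X i) ≤ (Y (i + 1) - Y i) * ((q j).1 - X i)
  turn : ∀ i, i + 2 < k → BelowEdge X Y i (X (i + 2)) (Y (i + 2))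

/-- The vertex `m` is a tangent point of the chain, seen from the point `(x, y)`. -/
def IsTangentIndex (k : ℕ) (X Y : ℕ → ℝ) (x y : ℝ) (m : ℕ) : Prop :=
  m < k ∧ (m = 0 ∨ BelowEdge X Y (m - 1) x y) ∧ (m + 1 = k ∨ ¬ BelowEdge X Y m x y)

namespace IsHullChain

variable {ε : ℝ} {q : ℕ → ℝ × ℝ} {n k : ℕ} {X Y : ℕ → ℝ}

theorem singleton (ε : ℝ) (q : ℕ → ℝ × ℝ) {X Y : ℕ → ℝ} (hX : X 0 = (q 0).1)
    (hY : Y 0 = (q 0).2 - ε) : IsHullChain ε q 1 1 X Y where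
  pos := le_rfl
  first := hX
  last := hX
  mem i hi := ⟨0, by omega, by obtain rfl : i = 0 := by omega
                               exact ⟨hX, hY⟩⟩
  lt i hi := by omega
  below i hi := by omega
  turn i hi := by omega

theorem lt_of_lt (h : IsHullChain ε q n k X Y) {i j : ℕ} (hij : i < j) (hj : j < k) :
    X i < X j := by
  induction j, hij using Nat.le_induction with
  | base => exact h.lt i hj
  | succ j hij ih => exact (ih (by omega)).trans (h.lt j hj)

theorem lt_new (h : IsHullChain ε q n k X Y) (hq : StrictMono fun i => (q i).1) {i : ℕ}
    (hi : i < k) : X i < (q n).1 := by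
  obtain ⟨j, hj, hX, _⟩ := h.mem i hi
  rw [hX]
  exact hq hj

/-- A point to the right that is below an edge is also below the edge before it. -/
theorem belowEdge_of_succ (h : IsHullChain ε q n k X Y) {x y : ℝ} (hx : ∀ i < k, X i < x) {i : ℕ}
    (hi : i + 2 < k) (hb : BelowEdge X Y (i + 1) x y) : BelowEdge X Y i x y := by
  have hu := sub_pos.2 (h.lt i (by omega))
  have hv := sub_pos.2 (h.lt (i + 1) hi)
  have hw := sub_pos.2 (hx (i + 1) (by omega))
  have ht := h.turn i hi
  unfold BelowEdge at *
  have h1 : (Y (i + 2) - Y (i + 1)) * (X (i + 1) - X i) <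
      (Y (i + 1) - Y i) * (X (i + 2) - X (i + 1)) := by linarith
  have h2 := mul_lt_mul_of_pos_right hb hu
  have h3 := mul_lt_mul_of_pos_right h1 hw
  have h4 : (y - Y (i + 1)) * (X (i + 1) - X i) < (Y (i + 1) - Y i) * (x - X (i + 1)) := by
    refine lt_of_mul_lt_mul_right ?_ hv.le
    change _ * (X (i + 2) - X (i + 1)) < _ * (X (i + 2) - X (i + 1))
    change _ * (X (i + 2) - X (i + 1)) * _ < _ at h2
    linarith
  linarith

theorem belowEdge_of_le (h : IsHullChain ε q n k X Y) {x y : ℝ} (hx : ∀ i < k, X i < x) {m : ℕ}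
    (hm : m + 1 < k) (hb : BelowEdge X Y m x y) {i : ℕ} (hi : i ≤ m) : BelowEdge X Y i x y := by
  induction m with
  | zero => obtain rfl : i = 0 := by omega
            exact hb
  | succ m ih =>
    rcases hi.eq_or_lt with rfl | hi
    · exact hb
    · exact ih (by omega) (h.belowEdge_of_succ hx hm hb) (by omega)

/-- No lower endpoint is above the tangent. -/
theorem below_tangent (h : IsHullChain ε q n k X Y) (hq : StrictMono fun i => (q i).1)
    {x y : ℝ} (hx : ∀ i < k, X i < x) {m : ℕ} (hm : IsTangentIndex k X Y x y m) {j : ℕ}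
    (hj : j < n) :
    ((q j).2 - ε - Y m) * (x - X m) ≤ (y - Y m) * ((q j).1 - X m) := by
  obtain ⟨hmk, hl, hr⟩ := hm
  have hw := sub_pos.2 (hx m hmk)
  obtain ⟨j₀, hj₀, hXm, hYm⟩ := h.mem m hmk
  by_cases hjj : j = j₀
  · subst hjj; rw [hXm, hYm]; simp
  rcases Nat.lt_or_gt_of_ne hjj with hlt | hlt
  · have hξ : (q j).1 - X m < 0 := by rw [hXm]; exact sub_neg.2 (hq hlt)
    rcases hl with rfl | hl
    · rw [h.first] at hξ
      exact absurd (hq.monotone (Nat.zero_le j)) (not_le.2 (sub_neg.1 hξ))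
    have hm0 : m ≠ 0 := by
      rintro rfl
      rw [h.first] at hξ
      exact absurd (hq.monotone (Nat.zero_le j)) (not_le.2 (sub_neg.1 hξ))
    obtain ⟨m, rfl⟩ := Nat.exists_eq_succ_of_ne_zero hm0
    have hu := sub_pos.2 (h.lt m hmk)
    have hb := h.below m hmk j hj
    unfold BelowEdge at hl
    simp only [Nat.succ_eq_add_one, Nat.add_sub_cancel] at *
    refine le_of_mul_le_mul_right ?_ hu
    have h1 : ((q j).2 - ε - Y (m + 1)) * (X (m + 1) - X m) ≤
      (Y (m + 1) - Y m) * ((q j).1 - X (m + 1)) := by linarith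
    have h2 : (y - Y (m + 1)) * (X (m + 1) - X m) ≤ (Y (m + 1) - Y m) * (x - X (m + 1)) := by
      linarith
    have h3 := mul_le_mul_of_nonneg_right h1 hw.le
    have h4 := mul_le_mul_of_nonpos_right h2 hξ.le
    linarith
  · have hξ : 0 < (q j).1 - X m := by rw [hXm]; exact sub_pos.2 (hq hlt)
    have hmk' : m + 1 ≠ k := by
      rintro rfl
      have := h.last
      rw [Nat.add_sub_cancel] at this
      rw [this] at hξ
      exact absurd (hq.monotone (by omega : j ≤ n - 1)) (not_le.2 (sub_pos.1 hξ))
    have hb := h.below m (by omega) j hj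
    have hv := sub_pos.2 (h.lt m (by omega))
    have hr' := not_lt.1 (hr.resolve_left hmk')
    refine le_of_mul_le_mul_right ?_ hv
    have h3 := mul_le_mul_of_nonneg_right hb hw.le
    have h4 := mul_le_mul_of_nonneg_right hr' hξ.le
    linarith

/-- The chain for one more point: the vertices after the tangent point are dropped. -/
theorem push (h : IsHullChain ε q n k X Y) (hq : StrictMono fun i => (q i).1) {m : ℕ}
    (hm : IsTangentIndex k X Y (q n).1 ((q n).2 - ε) m) :
    IsHullChain ε q (n + 1) (m + 2) (Function.update X (m + 1) (q n).1)
      (Function.update Y (m + 1) ((q n).2 - ε)) := by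
  have hx : ∀ i < k, X i < (q n).1 := fun i hi => h.lt_new hq hi
  have hmk := hm.1
  have oldX : ∀ i ≤ m, Function.update X (m + 1) (q n).1 i = X i := fun i hi =>
    Function.update_of_ne (by omega) _ _
  have oldY : ∀ i ≤ m, Function.update Y (m + 1) ((q n).2 - ε) i = Y i := fun i hi =>
    Function.update_of_ne (by omega) _ _
  have hkeep : ∀ i < m, BelowEdge X Y i (q n).1 ((q n).2 - ε) := fun i hi =>
    h.belowEdge_of_le hx (by omega) (hm.2.1.resolve_left (by omega)) (by omega)
  refine ⟨by omega, ?_, ?_, fun i hi => ?_, fun i hi => ?_, fun i hi j hj => ?_, fun i hi => ?_⟩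
  · rw [oldX 0 (Nat.zero_le m)]; exact h.first
  · simp
  · by_cases hi' : i = m + 1
    · subst hi'
      exact ⟨n, by omega, by simp⟩
    · obtain ⟨j, hj, h1, h2⟩ := h.mem i (by omega)
      exact ⟨j, by omega, by rw [oldX i (by omega), h1], by rw [oldY i (by omega), h2]⟩
  · by_cases hi' : i = m
    · subst hi'
      rw [oldX i le_rfl, Function.update_self]
      exact hx i hmk
    · rw [oldX i (by omega), oldX (i + 1) (by omega)]
      exact h.lt i (by omega)
  · by_cases hi' : i = m
    · subst hi'
      rw [oldX i le_rfl, oldY i le_rfl, Function.update_self, Function.update_self]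
      rcases Nat.lt_succ_iff_lt_or_eq.1 hj with hj | rfl
      · exact h.below_tangent hq hx hm hj
      · exact le_rfl
    · rw [oldX i (by omega), oldX (i + 1) (by omega), oldY i (by omega), oldY (i + 1) (by omega)]
      rcases Nat.lt_succ_iff_lt_or_eq.1 hj with hj | rfl
      · exact h.below i (by omega) j hj
      · exact (hkeep i (by omega)).le
  · unfold BelowEdge
    rw [oldX i (by omega), oldX (i + 1) (by omega), oldY i (by omega), oldY (i + 1) (by omega)]
    by_cases hi' : i + 1 = m
    · subst hi'
      rw [Function.update_self, Function.update_self]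
      exact hkeep i (by omega)
    · rw [oldX (i + 2) (by omega), oldY (i + 2) (by omega)]
      exact h.turn i (by omega)

/-- The slope of the edge from the vertex `i` to the next one. -/
noncomputable def edgeSlope (X Y : ℕ → ℝ) (i : ℕ) : ℝ := (Y (i + 1) - Y i) / (X (i + 1) - X i)

theorem mem_minHullVertices (h : IsHullChain ε q n k X Y) (hq : StrictMono fun i => (q i).1)
    {i : ℕ} (hi : i < k) : (X i, Y i) ∈ minHullVertices ε q n := by
  obtain ⟨j₀, hj₀, hX, hY⟩ := h.mem i hi
  -- A slope strictly between those of the two adjacent edges.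
  obtain ⟨t, htl, htr⟩ : ∃ t, (i = 0 ∨ t < edgeSlope X Y (i - 1)) ∧
      (i + 1 = k ∨ edgeSlope X Y i < t) := by
    by_cases h0 : i = 0
    · exact ⟨edgeSlope X Y i + 1, .inl h0, .inr (by linarith)⟩
    by_cases h1 : i + 1 = k
    · exact ⟨edgeSlope X Y (i - 1) - 1, .inr (by linarith), .inl h1⟩
    obtain ⟨i, rfl⟩ := Nat.exists_eq_succ_of_ne_zero h0
    have hlt : edgeSlope X Y (i + 1) < edgeSlope X Y i := by
      have ht := h.turn i (by omega)
      have hu := sub_pos.2 (h.lt i hi)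
      have hv := sub_pos.2 (h.lt (i + 1) (by omega))
      unfold edgeSlope
      rw [div_lt_div_iff₀ hv hu]
      unfold BelowEdge at ht
      change (Y (i + 2) - Y (i + 1)) * (X (i + 1) - X i) <
        (Y (i + 1) - Y i) * (X (i + 2) - X (i + 1))
      linarith
    obtain ⟨t, h2, h3⟩ := exists_between hlt
    exact ⟨t, .inr h3, .inr h2⟩
  rw [hX, hY]
  refine _root_.mem_minHullVertices hq hj₀ t fun j hj hjj => ?_
  rcases Nat.lt_or_gt_of_ne hjj with hlt | hlt
  · have hξ : (q j).1 - X i < 0 := by rw [hX]; exact sub_neg.2 (hq hlt)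
    have h0 : i ≠ 0 := by
      rintro rfl
      rw [h.first] at hξ
      exact absurd (hq.monotone (Nat.zero_le j)) (not_le.2 (sub_neg.1 hξ))
    obtain ⟨i, rfl⟩ := Nat.exists_eq_succ_of_ne_zero h0
    have hu := sub_pos.2 (h.lt i hi)
    have h1 := mul_lt_mul_of_neg_right (htl.resolve_left h0) hξ
    have h2 : ((q j).2 - ε - Y (i + 1)) ≤ edgeSlope X Y i * ((q j).1 - X (i + 1)) := by
      unfold edgeSlope
      rw [div_mul_eq_mul_div, le_div_iff₀ hu]
      linarith [h.below i hi j hj]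
    simp only [Nat.succ_eq_add_one, Nat.add_sub_cancel] at *
    rw [← hX]
    linarith
  · have hξ : 0 < (q j).1 - X i := by rw [hX]; exact sub_pos.2 (hq hlt)
    have hik : i + 1 ≠ k := by
      rintro rfl
      have := h.last
      rw [Nat.add_sub_cancel] at this
      rw [this] at hξ
      exact absurd (hq.monotone (by omega : j ≤ n - 1)) (not_le.2 (sub_pos.1 hξ))
    have hv := sub_pos.2 (h.lt i (by omega))
    have h1 := mul_lt_mul_of_pos_right (htr.resolve_left hik) hξ
    have h2 : ((q j).2 - ε - Y i) ≤ edgeSlope X Y i * ((q j).1 - X i) := by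
      unfold edgeSlope
      rw [div_mul_eq_mul_div, le_div_iff₀ hv]
      exact h.below i (by omega) j hj
    rw [← hX]
    linarith

theorem card_le (h : IsHullChain ε q n k X Y) (hq : StrictMono fun i => (q i).1) :
    k ≤ (minHullVertices ε q n).ncard := by
  have hfin : (minHullVertices ε q n).Finite := by
    refine Set.Finite.subset ?_ (minHullVertices_subset ε q n)
    refine ((Finset.range n).finite_toSet.image fun i => ((q i).1, (q i).2 - ε)).subset ?_
    rintro _ ⟨i, hi, rfl⟩
    exact ⟨i, by simpa using hi, rfl⟩
  have hinj : Set.InjOn (fun i => (X i, Y i)) (Finset.range k : Set ℕ) := by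
    intro i hi j hj hij
    simp only [Finset.coe_range, Set.mem_Iio] at hi hj
    by_contra hne
    have e := (Prod.ext_iff.1 hij).1
    rcases Nat.lt_or_gt_of_ne hne with hlt | hlt
    · exact (h.lt_of_lt hlt hj).ne e
    · exact (h.lt_of_lt hlt hi).ne' e
  calc k = ((fun i => (X i, Y i)) '' (Finset.range k : Set ℕ)).ncard := by
        rw [hinj.ncard_image, Set.ncard_coe_finset, Finset.card_range]
    _ ≤ _ := Set.ncard_le_ncard (by
        rintro _ ⟨i, hi, rfl⟩
        exact h.mem_minHullVertices hq (by simpa using hi)) hfin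

end IsHullChain

theorem slopeLe_succ {ε : ℝ} {q : ℕ → ℝ × ℝ} {n : ℕ} {a : ℝ} : SlopeLe ε q (n + 1) a ↔
    SlopeLe ε q n a ∧ ∀ i < n, a * ((q n).1 - (q i).1) ≤ (q n).2 - (q i).2 + 2 * ε := by
  constructor
  · intro h
    exact ⟨fun j hj => h j (by omega), h n (by omega)⟩
  · rintro ⟨h1, h2⟩ j hj
    rcases Nat.lt_succ_iff_lt_or_eq.1 hj with hj | rfl
    · exact h1 j hj
    · exact h2

/-- Among the segments from the lower endpoints to a new upper endpoint, the tangent of the min hull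
has the smallest slope. -/
theorem IsHullChain.forall_le_iff_le_tangentSlope {ε : ℝ} {q : ℕ → ℝ × ℝ} {n k : ℕ}
    {X Y : ℕ → ℝ} (h : IsHullChain ε q n k X Y) (hq : StrictMono fun i => (q i).1) {m : ℕ}
    (hm : IsTangentIndex k X Y (q n).1 ((q n).2 + ε) m) {a : ℝ} :
    (∀ i < n, a * ((q n).1 - (q i).1) ≤ (q n).2 - (q i).2 + 2 * ε) ↔
      a ≤ ((q n).2 + ε - Y m) / ((q n).1 - X m) := by
  have hD := sub_pos.2 (h.lt_new hq hm.1)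
  constructor
  · intro ha
    obtain ⟨j, hj, hX, hY⟩ := h.mem m hm.1
    rw [le_div_iff₀ hD, hX, hY]
    linarith [ha j hj]
  · intro ha i hi
    set c := ((q n).2 + ε - Y m) / ((q n).1 - X m)
    have hc : c * ((q n).1 - X m) = (q n).2 + ε - Y m := div_mul_cancel₀ _ hD.ne'
    have h1 := h.below_tangent hq (fun i hi => h.lt_new hq hi) hm hi
    rw [← hc] at h1
    have h2 : (q i).2 - ε - Y m ≤ c * ((q i).1 - X m) := by
      refine le_of_mul_le_mul_right ?_ hD
      linarith
    have h3 := mul_le_mul_of_nonneg_right ha (sub_pos.2 (hq hi)).le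
    linarith

/-- What is stored about the min hull of the first `n` points: its vertices, and the smallest
slope `A` of a segment from a lower endpoint to a later upper endpoint, if there are two points. -/
structure IsSideData (ε : ℝ) (q : ℕ → ℝ × ℝ) (n k : ℕ) (X Y : ℕ → ℝ) (A : ℝ) : Prop where
  chain : IsHullChain ε q n k X Y
  slope : 2 ≤ n → ∀ a, SlopeLe ε q n a ↔ a ≤ A

theorem IsSideData.step {ε : ℝ} {q : ℕ → ℝ × ℝ} {n k : ℕ} {X Y : ℕ → ℝ} {A A' : ℝ}
    (h : IsSideData ε q n k X Y A) (hq : StrictMono fun i => (q i).1) {m₁ m₂ : ℕ}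
    (hm₁ : IsTangentIndex k X Y (q n).1 ((q n).2 + ε) m₁)
    (hm₂ : IsTangentIndex k X Y (q n).1 ((q n).2 - ε) m₂)
    (hA1 : n ≤ 1 → A' = ((q n).2 + ε - Y m₁) / ((q n).1 - X m₁))
    (hA2 : 2 ≤ n → A' = min A (((q n).2 + ε - Y m₁) / ((q n).1 - X m₁))) :
    IsSideData ε q (n + 1) (m₂ + 2) (Function.update X (m₂ + 1) (q n).1)
      (Function.update Y (m₂ + 1) ((q n).2 - ε)) A' where
  chain := h.chain.push hq hm₂
  slope _ a := by
    rw [slopeLe_succ, h.chain.forall_le_iff_le_tangentSlope hq hm₁]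
    by_cases hn1 : n ≤ 1
    · rw [hA1 hn1]
      exact ⟨fun h => h.2, fun h => ⟨fun j hj i hi => by omega, h⟩⟩
    · rw [hA2 (by omega), le_min_iff, h.slope (by omega)]

theorem hasValidLine_iff_of_isSideData {ε : ℝ} (hε : 0 ≤ ε) {p : ℕ → ℝ × ℝ} {n k k' : ℕ}
    {X Y X' Y' : ℕ → ℝ} {A A' : ℝ} (h : IsSideData ε p n k X Y A)
    (h' : IsSideData ε (reflect p) n k' X' Y' A') (hn : 2 ≤ n) :
    HasValidLine ε p n ↔ 0 ≤ A + A' := by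
  rw [hasValidLine_iff_exists_slope hε]
  simp only [h.slope hn, h'.slope hn]
  constructor
  · rintro ⟨a, h1, h2⟩
    linarith
  · intro h
    exact ⟨A, le_rfl, by linarith⟩

/-! ### The program -/

namespace RealRAM

/-- Straight-line code. -/
def block : List Instr → Program
  | [] => .skip
  | i :: l => .seq (.instr i) (block l)

theorem exec_block (l : List Instr) (s : State) :
    Exec (block l) s (l.length + 1) (l.foldl (fun s i => i.apply s) s) := by
  induction l generalizing s with
  | nil => exact .skip s
  | cons i l ih =>
    rw [List.length_cons, add_comm (l.length + 1) 1]
    exact .seq (.instr i s) (ih _)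

/-- One round of the binary search.  The current interval is given by the natural number variables
`5` and `7`; variable `6` holds one more than variable `5`, and variable `1` holds the constant
`1`.  The chain is in the real arrays `b` and `2 + b`, and the point in the real variables `0`
and `6`. -/
def searchBody (b : ℕ) : Program :=
  .seq (block [.natAdd 8 5 7, .natHalf 8 8, .natAdd 9 8 1, .realLoad 10 b 8,
    .realLoad 11 (2 + b) 8, .realLoad 12 b 9, .realLoad 13 (2 + b) 9, .realSub 14 12 10,
    .realSub 15 13 11, .realSub 16 0 10, .realSub 17 6 11, .realMul 15 15 16, .realMul 17 17 14])
  (.seq (.ite (.realLe 15 17) (.instr (.natCopy 7 8)) (.instr (.natCopy 5 9)))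
    (.instr (.natAdd 6 5 1)))

/-- Binary search for a tangent index of the chain with `nat (20 + b)` vertices; the result is in
the natural number variable `5`. -/
def search (b : ℕ) : Program :=
  .seq (block [.natConst 5 0, .natConst 6 1, .natSub 7 (20 + b) 1])
    (.loop (.natLe 6 7) (searchBody b))

/-- The update for one side.  The new point is in the real variables `0` and `5`, the threshold in
the real variable `2`, and the number of earlier points in the natural number variable `2`.  The
smallest slope is kept in the real variable `20 + b`. -/
def sideUpdate (b : ℕ) : Program :=
  .seq (block [.realAdd 6 5 2]) <|
  .seq (search b) <|
  .seq (block [.realLoad 10 b 5, .realLoad 11 (2 + b) 5, .realSub 12 6 11, .realSub 13 0 10,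
    .realDiv 12 12 13]) <|
  .seq (.ite (.natLe 2 1) (.instr (.realCopy (20 + b) 12))
    (.ite (.realLe (20 + b) 12) .skip (.instr (.realCopy (20 + b) 12)))) <|
  .seq (block [.realSub 6 5 2]) <|
  .seq (search b)
    (block [.natAdd 9 5 1, .realStore b 9 0, .realStore (2 + b) 9 6, .natAdd (20 + b) 9 1])

/-- The streaming algorithm: side `0` stores the min hull of the stream and side `1` that of the
reflected stream.  The natural number variable `4` and the real variable `4` are never written and
hold the constant `0`. -/
def validLineProgram : Program :=
  .ite (.natLe 2 4)
    (block [.natConst 0 1, .natConst 1 1, .natConst 2 1, .natConst 20 1, .natConst 21 1,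
      .realSub 6 1 2, .realSub 5 4 1, .realSub 7 5 2, .realStore 0 4 0, .realStore 2 4 6,
      .realStore 1 4 0, .realStore 3 4 7])
    (.seq (block [.realCopy 5 1]) <|
      .seq (sideUpdate 0) <|
      .seq (block [.realSub 5 4 1]) <|
      .seq (sideUpdate 1) <|
      .seq (block [.natAdd 2 2 1, .natConst 0 0, .realAdd 7 20 21])
        (.ite (.realLe 4 7) (.instr (.natConst 0 1)) .skip))

/-! ### Correctness of the binary search -/

/-- The search changes only its work variables. -/
structure SearchFrame (s s' : State) : Prop where
  nat : ∀ j, j < 5 ∨ 20 ≤ j → s'.nat j = s.nat j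
  real : ∀ j, j < 10 ∨ 20 ≤ j → s'.real j = s.real j
  realArr : s'.realArr = s.realArr

theorem SearchFrame.refl (s : State) : SearchFrame s s := ⟨fun _ _ => rfl, fun _ _ => rfl, rfl⟩

theorem SearchFrame.trans {s s' s'' : State} (h : SearchFrame s s') (h' : SearchFrame s' s'') :
    SearchFrame s s'' :=
  ⟨fun j hj => (h'.nat j hj).trans (h.nat j hj), fun j hj => (h'.real j hj).trans (h.real j hj),
    h'.realArr.trans h.realArr⟩

/-- The point that is looked up lies below the edge `i` of the chain of the side `b`. -/
def State.QueryBelowEdge (s : State) (b i : ℕ) : Prop :=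
  BelowEdge (s.realArr b) (s.realArr (2 + b)) i (s.real 0) (s.real 6)

theorem SearchFrame.queryBelowEdge {s s' : State} (h : SearchFrame s s') (b i : ℕ) :
    s'.QueryBelowEdge b i ↔ s.QueryBelowEdge b i := by
  unfold State.QueryBelowEdge
  rw [h.realArr, h.real 0 (by omega), h.real 6 (by omega)]

theorem exec_searchBody (b : ℕ) (s : State) (h1 : s.nat 1 = 1) :
    ∃ s', Exec (searchBody b) s 17 s' ∧ SearchFrame s s' ∧ s'.nat 6 = s'.nat 5 + 1 ∧
      ((s.QueryBelowEdge b ((s.nat 5 + s.nat 7) / 2) ∧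
          s'.nat 5 = (s.nat 5 + s.nat 7) / 2 + 1 ∧ s'.nat 7 = s.nat 7) ∨
        (¬ s.QueryBelowEdge b ((s.nat 5 + s.nat 7) / 2) ∧
          s'.nat 5 = s.nat 5 ∧ s'.nat 7 = (s.nat 5 + s.nat 7) / 2)) := by
  have hb := exec_block [.natAdd 8 5 7, .natHalf 8 8, .natAdd 9 8 1, .realLoad 10 b 8,
    .realLoad 11 (2 + b) 8, .realLoad 12 b 9, .realLoad 13 (2 + b) 9, .realSub 14 12 10,
    .realSub 15 13 11, .realSub 16 0 10, .realSub 17 6 11, .realMul 15 15 16, .realMul 17 17 14] s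
  simp only [List.foldl, List.length, Instr.apply, State.setNat, State.setReal] at hb
  revert hb
  generalize hs₁ : State.mk _ _ _ _ = s₁
  intro hb
  have hn : ∀ j, j ≠ 8 → j ≠ 9 → s₁.nat j = s.nat j := by
    intro j h8 h9; subst hs₁; simp [h8, h9]
  have h8 : s₁.nat 8 = (s.nat 5 + s.nat 7) / 2 := by
    subst hs₁; simp
  have h9 : s₁.nat 9 = (s.nat 5 + s.nat 7) / 2 + 1 := by
    subst hs₁; simp [h1]
  have hr : ∀ j, j < 10 ∨ 20 ≤ j → s₁.real j = s.real j := by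
    intro j hj; subst hs₁
    have : j ≠ 10 ∧ j ≠ 11 ∧ j ≠ 12 ∧ j ≠ 13 ∧ j ≠ 14 ∧ j ≠ 15 ∧ j ≠ 16 ∧ j ≠ 17 := by omega
    simp [this]
  have ha : s₁.realArr = s.realArr := by subst hs₁; rfl
  have hT : Test.Holds (.realLe 15 17) s₁ ↔
      ¬ s.QueryBelowEdge b ((s.nat 5 + s.nat 7) / 2) := by
    unfold State.QueryBelowEdge BelowEdge
    rw [not_lt]
    subst hs₁
    simp [Test.Holds, h1]
  by_cases hq : s.QueryBelowEdge b ((s.nat 5 + s.nat 7) / 2)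
  · refine ⟨_, .seq hb (.seq (.iteFalse (mt hT.1 (not_not.2 hq)) (.instr _ _)) (.instr _ _)),
      ⟨fun j hj => ?_, hr, ha⟩, ?_, .inl ⟨hq, ?_, ?_⟩⟩
    · have : j ≠ 5 ∧ j ≠ 6 ∧ j ≠ 8 ∧ j ≠ 9 := by omega
      simp [Instr.apply, State.setNat, this, hn]
    · simp [Instr.apply, State.setNat, hn, h1]
    · simp [Instr.apply, State.setNat, h9]
    · simp [Instr.apply, State.setNat, hn]
  · refine ⟨_, .seq hb (.seq (.iteTrue (hT.2 hq) (.instr _ _)) (.instr _ _)),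
      ⟨fun j hj => ?_, hr, ha⟩, ?_, .inr ⟨hq, ?_, ?_⟩⟩
    · have : j ≠ 6 ∧ j ≠ 7 ∧ j ≠ 8 ∧ j ≠ 9 := by omega
      simp [Instr.apply, State.setNat, this, hn]
    · simp [Instr.apply, State.setNat, hn, h1]
    · simp [Instr.apply, State.setNat, hn]
    · simp [Instr.apply, State.setNat, h8]

theorem exec_search_loop (b k j : ℕ) : ∀ s : State, s.nat 1 = 1 → s.nat 6 = s.nat 5 + 1 →
    s.nat 5 ≤ s.nat 7 → s.nat 7 + 1 ≤ k → (s.nat 5 = 0 ∨ s.QueryBelowEdge b (s.nat 5 - 1)) →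
    (s.nat 7 + 1 = k ∨ ¬ s.QueryBelowEdge b (s.nat 7)) → s.nat 7 - s.nat 5 < 2 ^ j →
    ∃ t s', Exec (.loop (.natLe 6 7) (searchBody b)) s t s' ∧ t ≤ 18 * j + 1 ∧
      SearchFrame s s' ∧ s'.nat 5 < k ∧ (s'.nat 5 = 0 ∨ s.QueryBelowEdge b (s'.nat 5 - 1)) ∧
      (s'.nat 5 + 1 = k ∨ ¬ s.QueryBelowEdge b (s'.nat 5)) := by
  induction j with
  | zero =>
    intro s h1 h6 hle hk hl hr hj
    have e : s.nat 7 = s.nat 5 := by omega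
    refine ⟨1, s, .loopFalse ?_, by omega, .refl s, by omega, hl, by rwa [e] at hr⟩
    simp only [Test.Holds]; omega
  | succ j ih =>
    intro s h1 h6 hle hk hl hr hj
    by_cases hT : s.nat 6 ≤ s.nat 7
    · obtain ⟨s₁, hex, hfr, h6', hcase⟩ := exec_searchBody b s h1
      have h1' : s₁.nat 1 = 1 := (hfr.nat 1 (by omega)).trans h1
      rw [pow_succ] at hj
      have main : ∃ t s', Exec (.loop (.natLe 6 7) (searchBody b)) s₁ t s' ∧ t ≤ 18 * j + 1 ∧
          SearchFrame s₁ s' ∧ s'.nat 5 < k ∧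
          (s'.nat 5 = 0 ∨ s₁.QueryBelowEdge b (s'.nat 5 - 1)) ∧
          (s'.nat 5 + 1 = k ∨ ¬ s₁.QueryBelowEdge b (s'.nat 5)) := by
        rcases hcase with ⟨hq, h5, h7⟩ | ⟨hq, h5, h7⟩
        · refine ih s₁ h1' h6' (by omega) (by omega) (.inr ?_) ?_ (by omega)
          · rw [hfr.queryBelowEdge, h5, Nat.add_sub_cancel]; exact hq
          · rw [hfr.queryBelowEdge, h7]; exact hr
        · refine ih s₁ h1' h6' (by omega) (by omega) ?_ (.inr ?_) (by omega)
          · rw [hfr.queryBelowEdge, h5]; exact hl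
          · rw [hfr.queryBelowEdge, h7]; exact hq
      obtain ⟨t, s', hex', ht, hfr', hlt, h3, h4⟩ := main
      simp only [hfr.queryBelowEdge] at h3 h4
      exact ⟨_, s', .loopTrue hT hex hex', by omega, hfr.trans hfr', hlt, h3, h4⟩
    · have e : s.nat 7 = s.nat 5 := by omega
      exact ⟨1, s, .loopFalse hT, by omega, .refl s, by omega, hl, by rwa [e] at hr⟩

theorem exec_search (b : ℕ) (s : State) (h1 : s.nat 1 = 1) (hk : 1 ≤ s.nat (20 + b)) :
    ∃ t s', Exec (search b) s t s' ∧ t ≤ 18 * Nat.log 2 (s.nat (20 + b)) + 23 ∧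
      SearchFrame s s' ∧ IsTangentIndex (s.nat (20 + b)) (s.realArr b) (s.realArr (2 + b))
        (s.real 0) (s.real 6) (s'.nat 5) := by
  have hb := exec_block [.natConst 5 0, .natConst 6 1, .natSub 7 (20 + b) 1] s
  simp only [List.foldl, List.length, Instr.apply, State.setNat] at hb
  revert hb
  generalize hs₁ : State.mk _ _ _ _ = s₁
  intro hb
  have hfr : SearchFrame s s₁ := by
    subst hs₁
    refine ⟨fun j hj => ?_, fun _ _ => rfl, rfl⟩
    have : j ≠ 5 ∧ j ≠ 6 ∧ j ≠ 7 := by omega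
    simp [this]
  have h5 : s₁.nat 5 = 0 := by subst hs₁; simp
  have h6 : s₁.nat 6 = 1 := by subst hs₁; simp
  have h7 : s₁.nat 7 = s.nat (20 + b) - 1 := by
    subst hs₁
    have : 20 + b ≠ 5 ∧ 20 + b ≠ 6 := by omega
    simp [h1, this]
  have hlog := Nat.lt_pow_succ_log_self (b := 2) (by norm_num) (s.nat (20 + b))
  obtain ⟨t, s', hex, ht, hfr', hlt, hl, hr⟩ := exec_search_loop b (s.nat (20 + b))
    (Nat.log 2 (s.nat (20 + b)) + 1) s₁ ((hfr.nat 1 (by omega)).trans h1) (by omega) (by omega)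
    (by omega) (.inl h5) (.inl (by omega)) (by rw [← Nat.succ_eq_add_one]; omega)
  simp only [hfr.queryBelowEdge] at hl hr
  exact ⟨_, s', .seq hb hex, by omega, hfr.trans hfr', hlt, hl, hr⟩

/-! ### Correctness of the update of one side -/

/-- The data of the side `b` that are kept in the memory describe the first `n` points of `q`. -/
def State.HoldsSide (s : State) (b : ℕ) (ε : ℝ) (q : ℕ → ℝ × ℝ) (n : ℕ) : Prop :=
  IsSideData ε q n (s.nat (20 + b)) (s.realArr b) (s.realArr (2 + b)) (s.real (20 + b))

/-- The update of the side `b` changes only the data of this side and work variables. -/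
structure SideFrame (b : ℕ) (s s' : State) : Prop where
  nat : ∀ j, j < 5 ∨ (20 ≤ j ∧ j ≠ 20 + b) → s'.nat j = s.nat j
  real : ∀ j, j < 6 ∨ (20 ≤ j ∧ j ≠ 20 + b) → s'.real j = s.real j
  realArr : ∀ j, j ≠ b → j ≠ 2 + b → s'.realArr j = s.realArr j

theorem exec_sideUpdate (b : ℕ) {ε : ℝ} {q : ℕ → ℝ × ℝ} (hq : StrictMono fun i => (q i).1)
    {n : ℕ} (s : State) (h1 : s.nat 1 = 1) (h2 : s.nat 2 = n) (hx : s.real 0 = (q n).1)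
    (hy : s.real 5 = (q n).2) (he : s.real 2 = ε) (hs : s.HoldsSide b ε q n) :
    ∃ t s', Exec (sideUpdate b) s t s' ∧ t ≤ 36 * Nat.log 2 (s.nat (20 + b)) + 70 ∧
      SideFrame b s s' ∧ s'.HoldsSide b ε q (n + 1) := by
  have hk := hs.chain.pos
  -- The tangent from the new upper endpoint.
  have e₁ := exec_block [.realAdd 6 5 2] s
  simp only [List.foldl, List.length, Instr.apply] at e₁
  set s₁ := s.setReal 6 (s.real 5 + s.real 2) with hs₁
  have r₁ : ∀ j, j ≠ 6 → s₁.real j = s.real j := fun j hj => by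
    simp [hs₁, State.setReal, hj]
  have r₁6 : s₁.real 6 = (q n).2 + ε := by simp [hs₁, State.setReal, hy, he]
  obtain ⟨t₂, s₂, e₂, ht₂, f₂, hm₁⟩ := exec_search b s₁ h1 hk
  rw [r₁ 0 (by omega), r₁6, hx] at hm₁
  change IsTangentIndex (s.nat (20 + b)) (s.realArr b) (s.realArr (2 + b)) _ _ _ at hm₁
  change t₂ ≤ 18 * Nat.log 2 (s.nat (20 + b)) + 23 at ht₂
  -- Its slope.
  have e₃ := exec_block [.realLoad 10 b 5, .realLoad 11 (2 + b) 5, .realSub 12 6 11,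
    .realSub 13 0 10, .realDiv 12 12 13] s₂
  simp only [List.foldl, List.length, Instr.apply, State.setReal] at e₃
  revert e₃
  generalize hs₃ : State.mk _ _ _ _ = s₃
  intro e₃
  have n₃ : s₃.nat = s₂.nat := by subst hs₃; rfl
  have a₃ : s₃.realArr = s.realArr := by subst hs₃; exact f₂.realArr
  have r₃ : ∀ j, j < 6 ∨ 20 ≤ j → s₃.real j = s.real j := fun j hj => by
    rw [← r₁ j (by omega), ← f₂.real j (by omega)]
    subst hs₃
    have : j ≠ 10 ∧ j ≠ 11 ∧ j ≠ 12 ∧ j ≠ 13 := by omega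
    simp [this]
  set c := ((q n).2 + ε - s.realArr (2 + b) (s₂.nat 5)) / ((q n).1 - s.realArr b (s₂.nat 5))
    with hc
  have r₃c : s₃.real 12 = c := by
    subst hs₃
    simp [hc, f₂.real, f₂.realArr, hs₁, State.setReal, hx, hy, he]
  have n₃' : ∀ j, j < 5 ∨ 20 ≤ j → s₃.nat j = s.nat j := fun j hj => by
    rw [n₃]; exact f₂.nat j hj
  -- The new minimum of the slopes.
  have e₄ : ∃ t₄ A', Exec (.ite (.natLe 2 1) (.instr (.realCopy (20 + b) 12))
      (.ite (.realLe (20 + b) 12) .skip (.instr (.realCopy (20 + b) 12)))) s₃ t₄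
        (s₃.setReal (20 + b) A') ∧ t₄ ≤ 3 ∧
        (n ≤ 1 → A' = c) ∧ (2 ≤ n → A' = min (s.real (20 + b)) c) := by
    have hT : Test.Holds (.natLe 2 1) s₃ ↔ n ≤ 1 := by
      simp only [Test.Holds]
      rw [n₃' 2 (by omega), n₃' 1 (by omega), h1, h2]
    by_cases hn : n ≤ 1
    · exact ⟨_, _, .iteTrue (hT.2 hn) (.instr _ _), by omega, fun _ => r₃c, fun h => by omega⟩
    · have hT' : Test.Holds (.realLe (20 + b) 12) s₃ ↔ s.real (20 + b) ≤ c := by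
        simp only [Test.Holds]
        rw [r₃ (20 + b) (by omega), r₃c]
      by_cases hA : s.real (20 + b) ≤ c
      · have hskip : s₃.setReal (20 + b) (s.real (20 + b)) = s₃ := by
          rw [← r₃ (20 + b) (by omega)]
          simp [State.setReal]
        refine ⟨3, s.real (20 + b), ?_, by omega, fun h => absurd h hn,
          fun _ => (min_eq_left hA).symm⟩
        rw [hskip]
        exact .iteFalse (mt hT.1 hn) (.iteTrue (hT'.2 hA) (.skip _))
      · exact ⟨_, _, .iteFalse (mt hT.1 hn) (.iteFalse (mt hT'.1 hA) (.instr _ _)), by omega,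
          fun h => absurd h hn, fun _ => r₃c.trans (min_eq_right (not_le.1 hA).le).symm⟩
  obtain ⟨t₄, A', e₄, ht₄, hA1, hA2⟩ := e₄
  -- The tangent from the new lower endpoint.
  have e₅ := exec_block [.realSub 6 5 2] (s₃.setReal (20 + b) A')
  simp only [List.foldl, List.length, Instr.apply] at e₅
  revert e₅
  generalize hs₅ : State.setReal (s₃.setReal (20 + b) A') 6 _ = s₅
  intro e₅
  have n₅ : ∀ j, j < 5 ∨ 20 ≤ j → s₅.nat j = s.nat j := fun j hj => by
    subst hs₅; exact n₃' j hj
  have a₅ : s₅.realArr = s.realArr := by subst hs₅; exact a₃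
  have r₅ : ∀ j, j < 6 ∨ (20 ≤ j ∧ j ≠ 20 + b) → s₅.real j = s.real j := fun j hj => by
    rw [← r₃ j (by omega)]
    subst hs₅
    have : j ≠ 6 ∧ j ≠ 20 + b := by omega
    simp [State.setReal, this]
  have r₅6 : s₅.real 6 = (q n).2 - ε := by
    have h5 : 5 ≠ 20 + b ∧ 2 ≠ 20 + b := by omega
    subst hs₅
    simp [State.setReal, h5, r₃, hy, he]
  have r₅A : s₅.real (20 + b) = A' := by
    have : 20 + b ≠ 6 := by omega
    subst hs₅
    simp [State.setReal, this]
  obtain ⟨t₆, s₆, e₆, ht₆, f₆, hm₂⟩ := exec_search b s₅ ((n₅ 1 (by omega)).trans h1)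
    (by rw [n₅ _ (by omega)]; exact hk)
  rw [n₅ _ (by omega), a₅, r₅ 0 (by omega), r₅6, hx] at hm₂
  rw [n₅ _ (by omega)] at ht₆
  -- Storing the new vertex.
  have e₇ := exec_block [.natAdd 9 5 1, .realStore b 9 0, .realStore (2 + b) 9 6,
    .natAdd (20 + b) 9 1] s₆
  simp only [List.foldl, List.length, Instr.apply] at e₇
  have h61 : s₆.nat 1 = 1 := by rw [f₆.nat 1 (by omega), n₅ 1 (by omega), h1]
  have h60 : s₆.real 0 = (q n).1 := by rw [f₆.real 0 (by omega), r₅ 0 (by omega), hx]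
  have h66 : s₆.real 6 = (q n).2 - ε := by rw [f₆.real 6 (by omega), r₅6]
  have h6A : s₆.real (20 + b) = A' := by rw [f₆.real _ (by omega), r₅A]
  have h6a : s₆.realArr = s.realArr := f₆.realArr.trans a₅
  refine ⟨_, _, .seq e₁ (.seq e₂ (.seq e₃ (.seq e₄ (.seq e₅ (.seq e₆ e₇))))), by omega,
    ⟨fun j hj => ?_, fun j hj => ?_, fun j hj hj' => ?_⟩, ?_⟩
  · have : j ≠ 9 ∧ j ≠ 20 + b := by omega
    simp only [State.setNat, State.setRealArr, Function.update_apply, this, if_false]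
    rw [f₆.nat j (by omega), n₅ j (by omega)]
  · simp only [State.setNat, State.setRealArr]
    rw [f₆.real j (by omega), r₅ j hj]
  · simp only [State.setNat, State.setRealArr, Function.update_apply, hj, hj', if_false]
    rw [h6a]
  · have hstep := hs.step hq hm₁ hm₂ hA1 hA2
    unfold State.HoldsSide
    convert hstep using 1
    · simp [State.setNat, State.setRealArr, h61]
    · simp [State.setNat, State.setRealArr, h61, h60, h6a]
    · simp [State.setNat, State.setRealArr, h61, h66, h6a]
    · exact h6A

/-! ### Correctness and running time of the program -/

/-- The contents of the memory after `n ≥ 1` points. -/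
structure State.HoldsStream (s : State) (ε : ℝ) (p : ℕ → ℝ × ℝ) (n : ℕ) : Prop where
  one : s.nat 1 = 1
  count : s.nat 2 = n
  zero : s.nat 4 = 0
  threshold : s.real 2 = ε
  realZero : s.real 4 = 0
  minSide : s.HoldsSide 0 ε p n
  maxSide : s.HoldsSide 1 ε (reflect p) n

theorem hasValidLine_one {ε : ℝ} (hε : 0 ≤ ε) (p : ℕ → ℝ × ℝ) : HasValidLine ε p 1 :=
  ⟨0, (p 0).2, fun i hi => by
    obtain rfl : i = 0 := by omega
    simpa using hε⟩

theorem exec_validLineProgram_first {ε : ℝ} (hε : 0 ≤ ε) (p : ℕ → ℝ × ℝ) :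
    ∃ s', Exec validLineProgram ((initial ε).feed (p 0)) 14 s' ∧ s'.HoldsStream ε p 1 ∧
      (s'.SaysYes ↔ HasValidLine ε p 1) := by
  have e := exec_block [.natConst 0 1, .natConst 1 1, .natConst 2 1, .natConst 20 1,
    .natConst 21 1, .realSub 6 1 2, .realSub 5 4 1, .realSub 7 5 2, .realStore 0 4 0,
    .realStore 2 4 6, .realStore 1 4 0, .realStore 3 4 7] ((initial ε).feed (p 0))
  refine ⟨_, .iteTrue (by simp [Test.Holds, initial, State.feed, State.setReal]) e, ?_, ?_⟩
  · simp only [List.foldl, Instr.apply, State.setNat, State.setReal, State.setRealArr, initial,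
      State.feed]
    refine ⟨?_, ?_, ?_, ?_, ?_, ⟨.singleton ε p ?_ ?_, fun h => by omega⟩,
      ⟨.singleton ε (reflect p) ?_ ?_, fun h => by omega⟩⟩ <;>
    simp [reflect]
  · simp [State.SaysYes, Instr.apply, State.setNat, State.setReal, State.setRealArr,
      hasValidLine_one hε p]

theorem exec_validLineProgram_step {ε : ℝ} (hε : 0 ≤ ε) {p : ℕ → ℝ × ℝ}
    (hp : StrictMono fun i => (p i).1) {n : ℕ} (hn : 1 ≤ n) {s : State}
    (hs : s.HoldsStream ε p n) :
    ∃ t s', Exec validLineProgram (s.feed (p n)) t s' ∧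
      t ≤ 36 * Nat.log 2 (s.nat 20) + 36 * Nat.log 2 (s.nat 21) + 160 ∧
      s'.HoldsStream ε p (n + 1) ∧ (s'.SaysYes ↔ HasValidLine ε p (n + 1)) := by
  have e₁ := exec_block [.realCopy 5 1] (s.feed (p n))
  simp only [List.foldl, List.length, Instr.apply] at e₁
  revert e₁
  generalize hs₁ : State.setReal _ _ _ = s₁
  intro e₁
  have n₁ : s₁.nat = s.nat := by subst hs₁; rfl
  have a₁ : s₁.realArr = s.realArr := by subst hs₁; rfl
  have r₁ : ∀ j, j ≠ 0 → j ≠ 1 → j ≠ 5 → s₁.real j = s.real j := fun j h0 h1 h5 => by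
    subst hs₁; simp [State.feed, State.setReal, h0, h1, h5]
  have r₁0 : s₁.real 0 = (p n).1 := by subst hs₁; simp [State.feed, State.setReal]
  have r₁1 : s₁.real 1 = (p n).2 := by subst hs₁; simp [State.feed, State.setReal]
  have r₁5 : s₁.real 5 = (p n).2 := by subst hs₁; simp [State.feed, State.setReal]
  have hmin : s₁.HoldsSide 0 ε p n := by
    unfold State.HoldsSide
    rw [n₁, a₁, r₁ _ (by omega) (by omega) (by omega)]
    exact hs.minSide
  obtain ⟨t₂, s₂, e₂, ht₂, f₂, hmin₂⟩ := exec_sideUpdate 0 hp s₁ (by rw [n₁, hs.one])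
    (by rw [n₁, hs.count]) r₁0 r₁5 (by rw [r₁ 2 (by omega) (by omega) (by omega), hs.threshold])
    hmin
  have e₃ := exec_block [.realSub 5 4 1] s₂
  simp only [List.foldl, List.length, Instr.apply] at e₃
  revert e₃
  generalize hs₃ : State.setReal _ _ _ = s₃
  intro e₃
  have n₃ : ∀ j, j < 5 ∨ 21 ≤ j → s₃.nat j = s.nat j := fun j hj => by
    rw [← n₁, ← f₂.nat j (by omega)]; subst hs₃; rfl
  have r₃ : ∀ j, j ≠ 5 → s₃.real j = s₂.real j := fun j hj => by
    subst hs₃; simp [State.setReal, hj]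
  have r₃' : ∀ j, j = 2 ∨ j = 4 ∨ 21 ≤ j → s₃.real j = s.real j := fun j hj => by
    rw [r₃ j (by omega), f₂.real j (by omega), r₁ j (by omega) (by omega) (by omega)]
  have r₃5 : s₃.real 5 = (reflect p n).2 := by
    subst hs₃
    simp [State.setReal, reflect, f₂.real, r₁, r₁1, hs.realZero]
  have r₃0 : s₃.real 0 = (reflect p n).1 := by
    rw [r₃ 0 (by omega), f₂.real 0 (by omega), r₁0]; rfl
  have a₃ : ∀ j, j ≠ 0 → j ≠ 2 → s₃.realArr j = s.realArr j := fun j h0 h2 => by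
    rw [← a₁, ← f₂.realArr j h0 h2]; subst hs₃; rfl
  have hmin₃ : s₃.HoldsSide 0 ε p (n + 1) := by
    unfold State.HoldsSide
    rw [r₃ _ (by omega)]
    subst hs₃
    exact hmin₂
  have hmax : s₃.HoldsSide 1 ε (reflect p) n := by
    unfold State.HoldsSide
    rw [n₃ _ (by omega), a₃ _ (by omega) (by omega), a₃ _ (by omega) (by omega), r₃' _ (by omega)]
    exact hs.maxSide
  obtain ⟨t₄, s₄, e₄, ht₄, f₄, hmax₄⟩ := exec_sideUpdate 1 (q := reflect p) hp s₃
    (by rw [n₃ 1 (by omega), hs.one]) (by rw [n₃ 2 (by omega), hs.count]) r₃0 r₃5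
    (by rw [r₃' 2 (by omega), hs.threshold]) hmax
  have hmin₄ : s₄.HoldsSide 0 ε p (n + 1) := by
    unfold State.HoldsSide
    rw [f₄.nat _ (by omega), f₄.real _ (by omega), f₄.realArr _ (by omega) (by omega),
      f₄.realArr _ (by omega) (by omega)]
    exact hmin₃
  have e₅ := exec_block [.natAdd 2 2 1, .natConst 0 0, .realAdd 7 20 21] s₄
  simp only [List.foldl, List.length, Instr.apply, State.setNat, State.setReal] at e₅
  revert e₅
  generalize hs₅ : State.mk _ _ _ _ = s₅
  intro e₅
  have n₄ : ∀ j, j < 5 → s₄.nat j = s.nat j := fun j hj => by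
    rw [f₄.nat j (by omega), n₃ j (by omega)]
  have n₅ : ∀ j, j ≠ 0 → j ≠ 2 → s₅.nat j = s₄.nat j := fun j h0 h2 => by
    subst hs₅; simp [h0, h2]
  have n₅0 : s₅.nat 0 = 0 := by subst hs₅; simp
  have n₅2 : s₅.nat 2 = n + 1 := by
    subst hs₅; simp [n₄, hs.count, hs.one]
  have r₅ : ∀ j, j ≠ 7 → s₅.real j = s₄.real j := fun j h7 => by
    subst hs₅; simp [h7]
  have r₅7 : s₅.real 7 = s₄.real 20 + s₄.real 21 := by subst hs₅; simp
  have a₅ : s₅.realArr = s₄.realArr := by subst hs₅; rfl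
  have r₅4 : s₅.real 4 = 0 := by
    rw [r₅ 4 (by omega), f₄.real 4 (by omega), r₃' 4 (by omega), hs.realZero]
  have hs₅' : s₅.HoldsStream ε p (n + 1) := by
    refine ⟨?_, n₅2, ?_, ?_, r₅4, ?_, ?_⟩
    · rw [n₅ 1 (by omega) (by omega), n₄ 1 (by omega), hs.one]
    · rw [n₅ 4 (by omega) (by omega), n₄ 4 (by omega), hs.zero]
    · rw [r₅ 2 (by omega), f₄.real 2 (by omega), r₃' 2 (by omega), hs.threshold]
    · unfold State.HoldsSide
      rw [n₅ _ (by omega) (by omega), r₅ _ (by omega), a₅]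
      exact hmin₄
    · unfold State.HoldsSide
      rw [n₅ _ (by omega) (by omega), r₅ _ (by omega), a₅]
      exact hmax₄
  have hvalid : HasValidLine ε p (n + 1) ↔ Test.Holds (.realLe 4 7) s₅ := by
    rw [hasValidLine_iff_of_isSideData hε hmin₄ hmax₄ (by omega)]
    simp only [Test.Holds]
    rw [r₅4, r₅7]
  have hfirst : ¬ Test.Holds (.natLe 2 4) (s.feed (p n)) := by
    change ¬ s.nat 2 ≤ s.nat 4
    rw [hs.count, hs.zero]; omega
  rw [n₁] at ht₂
  rw [n₃ _ (by omega)] at ht₄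
  simp only [Nat.add_zero, Nat.reduceAdd] at ht₂ ht₄
  by_cases hT : Test.Holds (.realLe 4 7) s₅
  · refine ⟨_, _, .iteFalse hfirst (.seq e₁ (.seq e₂ (.seq e₃ (.seq e₄ (.seq e₅
      (.iteTrue hT (.instr _ _))))))), by omega, ?_, ?_⟩
    · -- Only the answer has changed.
      exact ⟨hs₅'.one, hs₅'.count, hs₅'.zero, hs₅'.threshold, hs₅'.realZero, hs₅'.minSide,
        hs₅'.maxSide⟩
    · simp [State.SaysYes, Instr.apply, State.setNat, hvalid, hT]
  · refine ⟨_, _, .iteFalse hfirst (.seq e₁ (.seq e₂ (.seq e₃ (.seq e₄ (.seq e₅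
      (.iteFalse hT (.skip _))))))), by omega, hs₅', ?_⟩
    simp [State.SaysYes, n₅0, hvalid, hT]

/-- The run of the program, with its answers and running times. -/
theorem exists_isRun_validLineProgram {ε : ℝ} (hε : 0 ≤ ε) {p : ℕ → ℝ × ℝ}
    (hp : StrictMono fun i => (p i).1) :
    ∃ (σ : ℕ → State) (τ : ℕ → ℕ), IsRun validLineProgram ε p σ τ ∧
      (∀ n, (σ (n + 1)).SaysYes ↔ HasValidLine ε p (n + 1)) ∧
      ∀ n, τ n ≤ 72 * Nat.log 2 (hullSize ε p n) + 160 := by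
  have hstep : ∀ n (s : State), ∃ t s', (n = 0 → s = initial ε) → (1 ≤ n → s.HoldsStream ε p n) →
      Exec validLineProgram (s.feed (p n)) t s' ∧ t ≤ 72 * Nat.log 2 (hullSize ε p n) + 160 ∧
      s'.HoldsStream ε p (n + 1) ∧ (s'.SaysYes ↔ HasValidLine ε p (n + 1)) := by
    intro n s
    rcases Nat.eq_zero_or_pos n with rfl | hn
    · obtain ⟨s', h1, h2, h3⟩ := exec_validLineProgram_first hε p
      exact ⟨14, s', fun hs _ => by rw [hs rfl]; exact ⟨h1, by omega, h2, h3⟩⟩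
    · by_cases hs : s.HoldsStream ε p n
      · obtain ⟨t, s', h1, ht, h2, h3⟩ := exec_validLineProgram_step hε hp hn hs
        refine ⟨t, s', fun _ _ => ⟨h1, ht.trans ?_, h2, h3⟩⟩
        have k0 : s.nat 20 ≤ hullSize ε p n :=
          (hs.minSide.chain.card_le hp).trans (le_max_left _ _)
        have k1 : s.nat 21 ≤ hullSize ε p n := by
          refine (hs.maxSide.chain.card_le (q := reflect p) hp).trans ?_
          rw [ncard_minHullVertices_reflect]
          exact le_max_right _ _
        have l0 := Nat.log_mono_right (b := 2) k0
        have l1 := Nat.log_mono_right (b := 2) k1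
        omega
      · exact ⟨0, s, fun _ h => absurd (h hn) hs⟩
  choose t next hnext using hstep
  let σ : ℕ → State := fun n => Nat.rec (initial ε) (fun n s => next n s) n
  have hσ : ∀ n, (n = 0 → σ n = initial ε) ∧ (1 ≤ n → (σ n).HoldsStream ε p n) := by
    intro n
    induction n with
    | zero => exact ⟨fun _ => rfl, fun h => by omega⟩
    | succ n ih => exact ⟨fun h => by omega, fun _ => (hnext n (σ n) ih.1 ih.2).2.2.1⟩
  have h := fun n => hnext n (σ n) (hσ n).1 (hσ n).2
  exact ⟨σ, fun n => t n (σ n), ⟨rfl, fun n => (h n).1⟩, fun n => (h n).2.2.2,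
    fun n => (h n).2.1⟩

theorem upper_bound {ε : ℝ} (hε : 0 ≤ ε) : DecidesValidLine validLineProgram ε ∧
    ∀ p : ℕ → ℝ × ℝ, StrictMono (fun i => (p i).1) →
      ∀ (σ : ℕ → State) (τ : ℕ → ℕ), IsRun validLineProgram ε p σ τ →
        ∀ n : ℕ, (τ n : ℝ) ≤ 464 * Real.log (max 2 (hullSize ε p n : ℝ)) := by
  refine ⟨fun p hp => ?_, fun p hp σ τ hrun n => ?_⟩
  · obtain ⟨σ, τ, h1, h2, _⟩ := exists_isRun_validLineProgram hε hp
    exact ⟨σ, τ, h1, h2⟩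
  · obtain ⟨σ', τ', h1, _, h3⟩ := exists_isRun_validLineProgram hε hp
    rw [hrun.time_eq h1 n]
    set h := hullSize ε p n
    have ht : τ' n ≤ 232 * Nat.log 2 (max 2 h) := by
      have l1 := Nat.log_mono_right (b := 2) (le_max_right 2 h)
      have l2 : Nat.log 2 2 ≤ Nat.log 2 (max 2 h) := Nat.log_mono_right (le_max_left 2 h)
      have l3 : Nat.log 2 2 = 1 := by norm_num
      have : τ' n ≤ 72 * Nat.log 2 h + 160 := h3 n
      omega
    have hpow : (2 : ℝ) ^ Nat.log 2 (max 2 h) ≤ max 2 (h : ℝ) := by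
      have := Nat.pow_log_le_self 2 (x := max 2 h) (by simp)
      exact_mod_cast this
    have hlog := Real.log_le_log (by positivity) hpow
    rw [Real.log_pow] at hlog
    have hl2 := Real.log_two_gt_d9
    have hL : (0 : ℝ) ≤ Nat.log 2 (max 2 h) := Nat.cast_nonneg _
    have ht' : (τ' n : ℝ) ≤ 232 * Nat.log 2 (max 2 h) := by exact_mod_cast ht
    nlinarith

end RealRAM

theorem mainTheorem1 :
    -- a program that spends `O(log h)` steps on each point
    (∃ (P : RealRAM.Program) (C : ℝ), ∀ ε : ℝ, 0 ≤ ε →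
      RealRAM.DecidesValidLine P ε ∧
      ∀ p : ℕ → ℝ × ℝ, StrictMono (fun i => (p i).1) →
        ∀ (σ : ℕ → RealRAM.State) (τ : ℕ → ℕ), RealRAM.IsRun P ε p σ τ →
          ∀ n : ℕ, (τ n : ℝ) ≤ C * Real.log (max 2 (hullSize ε p n : ℝ))) ∧
    -- every program needs `Ω(log h)` steps on some point
    (∃ (c : ℝ) (h₀ : ℕ), 0 < c ∧ ∀ ε : ℝ, 0 < ε → ∀ P : RealRAM.Program,
      RealRAM.DecidesValidLine P ε →
      ∀ h : ℕ, h₀ ≤ h →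
        ∃ (p : ℕ → ℝ × ℝ) (n : ℕ), StrictMono (fun i => (p i).1) ∧
          HasValidLine ε p n ∧ hullSize ε p n = h ∧
          ∀ (σ : ℕ → RealRAM.State) (τ : ℕ → ℕ), RealRAM.IsRun P ε p σ τ →
            c * Real.log h ≤ (τ n : ℝ)) :=
  ⟨⟨RealRAM.validLineProgram, 464, fun _ hε => RealRAM.upper_bound hε⟩,
    ⟨1 / 6, 5000, by norm_num, fun _ hε _ hP _ hh => RealRAM.lower_bound hε hP hh⟩⟩
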